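/- Let $\mathbb K$ be $\mathbb R$ or $\mathbb C$. A continuous linear operator $u:X\to Y$ between Banach spaces is absolutely $p$-summing ($1\le p<\infty$) if $(u(x_i))_{i}\in\ell_p(Y)$ whenever $(x_i)_{i\ge1}\subset X$ is weakly $p$-summable, i.e. $\|(x_i)_i\|_{w,p}:=\sup_{x^*\in B_{X^*}}\|(x^*(x_i))_i\|_p<\infty$. It is almost summing if there is $C\ge 0$ with $$\Big(\int_0^1\Big\|\sum_{i=1}^m r_i(t)u(x_i)\Big\|^2dt\Big)^{1/2}\le C\,\|(x_i)_{i=1}^m\|_{w,2}$$ for all $m$ and all $x_1,\dots,x_m\in X$, where $r_i$ are the Rademacher functions; the least such $C$ is denoted $\pi_{al.s}(u)$. Write $Y=\big(\sum_{k=3}^\infty \ell_k\big)_1$ for the $\ell_1$-sum of the spaces $\ell_k$, $k\ge3$, and let $i_k:\ell_k\to Y$ be the natural inclusions. (a) For every $k\ge 3$, every continuous linear operator $\ell_1\to\ell_k$ is absolutely $(k+1)$-summing and almost summing, and there is a continuous linear operator $\ell_1\to\ell_k$ that is not absolutely $k$-summing. (b) For each $k\ge3$ let $T_k:\ell_1\to\ell_k$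 be any continuous linear operator that is not absolutely $k$-summing, and put $C_k=2^k\,\pi_{al.s}(T_k)$. Then $C_k>0$ for all $k\geq 3$, every $\frac{i_k\circ T_k}{C_k}$ is almost summing, $$\sum_{k=3}^\infty\Big\|\frac{i_k\circ T_k}{C_k}\Big\|<\infty ,\qquad \sum_{k=3}^\infty\pi_{al.s}\Big(\frac{i_k\circ T_k}{C_k}\Big)<\infty ,$$ and the series $T=\sum_{k=3}^\infty \frac{i_k\circ T_k}{C_k}$ converges in the operator norm to an operator $T:\ell_1\to Y$. This $T$ is almost summing, the series also converges to $T$ in the norm $\pi_{al.s}$, and $T$ is not absolutely $p$-summing for any $1\le p<\infty$. In particular there is an almost summing operator $\ell_1\to Y$ that is not absolutely $p$-summing for any $1\le p<\infty$. -/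

import Mathlib

open scoped ENNReal NNReal Topology
open Filter MeasureTheory

noncomputable section

/-- The `ℓ_p` norm of a family of vectors, with value `∞` when the family is not `p`-summable. -/
def strongNorm {X ι : Type*} [NormedAddCommGroup X] (p : ℝ) (x : ι → X) : ℝ≥0∞ :=
  (∑' i, ‖x i‖ₑ ^ p) ^ (1 / p)

/-- The weak `ℓ_p` norm of a family of vectors: the supremum of the `ℓ_p` norms of `φ (x i)` over
the functionals `φ` in the closed unit ball of the dual. -/
def weakNorm (𝕜 : Type*) [RCLike 𝕜] {X ι : Type*} [NormedAddCommGroup X] [NormedSpace 𝕜 X]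
    (p : ℝ) (x : ι → X) : ℝ≥0∞ :=
  ⨆ φ : {φ : StrongDual 𝕜 X // ‖φ‖ ≤ 1}, strongNorm p (fun i => φ.1 (x i))

/-- Absolutely `p`-summing operators: weakly `p`-summable sequences are mapped to absolutely
`p`-summable sequences. -/
def IsPSumming {𝕜 X Y : Type*} [RCLike 𝕜] [NormedAddCommGroup X] [NormedSpace 𝕜 X]
    [NormedAddCommGroup Y] [NormedSpace 𝕜 Y] (p : ℝ) (u : X →L[𝕜] Y) : Prop :=
  ∀ x : ℕ → X, weakNorm 𝕜 p x < ∞ → strongNorm p (fun i => u (x i)) < ∞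

/-- The `n`-th Rademacher function: its sign on `[0, 1)` is governed by the `n`-th binary digit. -/
def rademacher (n : ℕ) (t : ℝ) : ℤ :=
  if Even ⌊(2 : ℝ) ^ n * t⌋ then 1 else -1

/-- The `L²` norm on `[0, 1]` of the Rademacher sum `∑ r_i(t) y_i`, where the `m` vectors `y_i` are
matched with the Rademacher functions of index `1, …, m`. -/
def radNorm {Y : Type*} [NormedAddCommGroup Y] {m : ℕ} (y : Fin m → Y) : ℝ≥0∞ :=
  (∫⁻ t in Set.Icc (0 : ℝ) 1, ‖∑ i : Fin m, rademacher ((i : ℕ) + 1) t • y i‖ₑ ^ 2) ^ (1 / 2 : ℝ)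

/-- `C` is an admissible constant in the definition of an almost summing operator. -/
def AlmostSummingBound {𝕜 X Y : Type*} [RCLike 𝕜] [NormedAddCommGroup X] [NormedSpace 𝕜 X]
    [NormedAddCommGroup Y] [NormedSpace 𝕜 Y] (u : X →L[𝕜] Y) (C : ℝ≥0) : Prop :=
  ∀ (m : ℕ) (x : Fin m → X), radNorm (fun i => u (x i)) ≤ C * weakNorm 𝕜 2 x

/-- Almost summing operators. -/
def IsAlmostSumming {𝕜 X Y : Type*} [RCLike 𝕜] [NormedAddCommGroup X] [NormedSpace 𝕜 X]
    [NormedAddCommGroup Y] [NormedSpace 𝕜 Y] (u : X →L[𝕜] Y) : Prop :=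
  ∃ C : ℝ≥0, AlmostSummingBound u C

/-- The almost summing norm `π_{al.s}(u)`: the least admissible constant
(meaningful when `u` is almost summing). -/
def almostSummingNorm {𝕜 X Y : Type*} [RCLike 𝕜] [NormedAddCommGroup X] [NormedSpace 𝕜 X]
    [NormedAddCommGroup Y] [NormedSpace 𝕜 Y] (u : X →L[𝕜] Y) : ℝ≥0 :=
  sInf {C : ℝ≥0 | AlmostSummingBound u C}

/-- The scalar sequence space `ℓ_p`. -/
abbrev Ell (𝕜 : Type*) [RCLike 𝕜] (p : ℝ≥0∞) : Type _ := lp (fun _ : ℕ => 𝕜) p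

/-- The indices `k = 3, 4, 5, …`. -/
abbrev Idx : Type := {k : ℕ // 3 ≤ k}

instance Idx.fact_one_le (k : Idx) : Fact (1 ≤ ((k : ℕ) : ℝ≥0∞)) :=
  ⟨by exact_mod_cast (le_trans (by norm_num) k.2 : 1 ≤ (k : ℕ))⟩

/-- The `ℓ_1`-sum of the spaces `ℓ_k`, `k ≥ 3`. -/
abbrev SumEll (𝕜 : Type*) [RCLike 𝕜] : Type _ :=
  lp (fun k : Idx => Ell 𝕜 ((k : ℕ) : ℝ≥0∞)) 1

/-- The natural inclusion of `ℓ_k` as the `k`-th summand. -/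
def inclEll (𝕜 : Type*) [RCLike 𝕜] (k : Idx) :
    Ell 𝕜 ((k : ℕ) : ℝ≥0∞) →L[𝕜] SumEll 𝕜 :=
  lp.singleContinuousLinearMap 𝕜 (fun k : Idx => Ell 𝕜 ((k : ℕ) : ℝ≥0∞)) 1 k

/-- The `k`-th term `(i_k ∘ T_k) / C_k` of the series, with `C_k = 2 ^ k * π_{al.s}(T_k)`. -/
def seriesTerm {𝕜 : Type*} [RCLike 𝕜]
    (S : ∀ k : Idx, Ell 𝕜 1 →L[𝕜] Ell 𝕜 ((k : ℕ) : ℝ≥0∞)) (k : Idx) :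
    Ell 𝕜 1 →L[𝕜] SumEll 𝕜 :=
  (((2 ^ (k : ℕ) * almostSummingNorm (S k) : ℝ) : 𝕜)⁻¹) • (inclEll 𝕜 k ∘L S k)

end

/-!
The theorem rests on facts about operators `u : ℓ_1 → ℓ_q` for `2 < q < r`. Write `α` and `β` for
the conjugate exponents of `q` and `r`, so that `1 < β < α < 2`. Everything is done with averages
`𝔼` over finite sets; the role of independent symmetric `α`-stable variables is played by products
`s i * v i` of independent signs `s i` and magnitudes `v i` uniformly distributed over the values
`(M / (m + 1)) ^ (1 / α)`, `m < M`.

*Upper estimate* (`Lq_stable_coeff_le`). The `ℓ_q`-norm of the coefficients `𝔼 g (s i * v i)` of a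
function `g` is at most a constant times the `L^r`-norm of `g`. Dually, `∑ a i * s i * v i` has
bounded `L^β`-norm when `∑ |a i| ^ α ≤ 1`: the part where `|a i| * v i ≤ 1` is bounded in `L²`,
the rest in `L^β`. This uses only the independence of the signs and the distribution of each
single `v i`.

*Summability.* If the magnitudes are pairwise independent, every vector of the unit ball of `ℓ_q`
is, up to a factor `8`, the coefficient vector of a function bounded by `1`
(`exists_bounded_with_stable_coeff`). Lifting the images of the unit vectors of `ℓ_1` in this way
gives functionals `φ z` in the dual ball of `ℓ_1` for which a fixed multiple of `u x` is the
coefficient vector of the function sending `z` to `φ z x`. So `‖u x‖ ≤ K (𝔼 ‖φ z x‖ ^ r) ^ (1 / r)`,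
uniformly over all finite sets of coordinates (`exists_domination`). Hence `u` is
absolutely `r`-summing, and by Khintchine's inequality it is almost summing.

*Sharpness* (`exists_not_isPSumming`). With magnitudes that are cyclic shifts of one another, the
sum of `|v i| ^ α` over `i < N` is the constant `N (1 + 1/2 + … + 1/N)`. Regarded as vectors of
`ℓ_1`, the signed variables are weakly `q`-summable with a constant independent of `N`, whereas
the operator sending the unit vectors to the normalised vectors `(s i * v i ^ (α - 1))_i` maps
them to vectors for which the sum of the `q`-th powers of the norms is at least the harmonic sum
raised to the power `q - 1`.

For the series, `π_{al.s}` of the `k`-th term is at most `2 ^ (-k)` by the choice of the factors. As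
`π_{al.s}` dominates the operator norm and is lower semicontinuous, the series converges in both
norms. Composing the sum `T` with the `k`-th coordinate projection gives a nonzero multiple of
`S k`; by the inclusion theorem `IsPSumming.mono`, `T` is not `p`-summing for any `p ≤ k`.
-/

open scoped BigOperators

/-! ### Absolutely summing operators -/

section Summing

variable {𝕜 X Y : Type*} [RCLike 𝕜] [NormedAddCommGroup X] [NormedSpace 𝕜 X]
  [NormedAddCommGroup Y] [NormedSpace 𝕜 Y] {ι : Type*}

lemma strongNorm_rpow {p : ℝ} (hp : 0 < p) (x : ι → X) :
    strongNorm p x ^ p = ∑' i, ‖x i‖ₑ ^ p := by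
  rw [strongNorm, ← ENNReal.rpow_mul, one_div_mul_cancel hp.ne', ENNReal.rpow_one]

lemma strongNorm_le_iff {p : ℝ} (hp : 0 < p) {x : ι → X} {C : ℝ≥0∞} :
    strongNorm p x ≤ C ↔ ∑' i, ‖x i‖ₑ ^ p ≤ C ^ p := by
  rw [← strongNorm_rpow hp, ENNReal.rpow_le_rpow_iff hp]

lemma tsum_le_weakNorm_rpow {p : ℝ} (hp : 0 < p) (x : ι → X) {φ : StrongDual 𝕜 X} (hφ : ‖φ‖ ≤ 1) :
    ∑' i, ‖φ (x i)‖ₑ ^ p ≤ weakNorm 𝕜 p x ^ p := by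
  rw [← strongNorm_le_iff hp]
  exact le_iSup (fun φ : {φ : StrongDual 𝕜 X // ‖φ‖ ≤ 1} => strongNorm p fun i => φ.1 (x i)) ⟨φ, hφ⟩

lemma weakNorm_le {p : ℝ} (hp : 0 < p) {x : ι → X} {C : ℝ≥0∞}
    (h : ∀ φ : StrongDual 𝕜 X, ‖φ‖ ≤ 1 → ∑' i, ‖φ (x i)‖ₑ ^ p ≤ C ^ p) : weakNorm 𝕜 p x ≤ C :=
  iSup_le fun φ => (strongNorm_le_iff hp).mpr (h φ.1 φ.2)

lemma strongNorm_smul {p : ℝ} (hp : 0 < p) (c : 𝕜) (x : ι → X) :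
    strongNorm p (fun i => c • x i) = ‖c‖ₑ * strongNorm p x := by
  simp only [strongNorm, enorm_smul, ENNReal.mul_rpow_of_nonneg _ _ hp.le, ENNReal.tsum_mul_left]
  rw [ENNReal.mul_rpow_of_nonneg _ _ (by positivity), ← ENNReal.rpow_mul,
    mul_one_div_cancel hp.ne', ENNReal.rpow_one]

lemma weakNorm_smul {p : ℝ} (hp : 0 < p) (c : 𝕜) (x : ι → X) :
    weakNorm 𝕜 p (fun i => c • x i) = ‖c‖ₑ * weakNorm 𝕜 p x := by
  simp only [weakNorm, map_smul, strongNorm_smul hp, ENNReal.mul_iSup]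

lemma strongNorm_extend {p : ℝ} (hp : 0 < p) {κ : Type*} {e : ι → κ} (he : e.Injective)
    (x : ι → X) : strongNorm p (Function.extend e x 0) = strongNorm p x := by
  have : ∀ i, ‖Function.extend e x 0 i‖ₑ ^ p = Function.extend e (fun i => ‖x i‖ₑ ^ p) 0 i := by
    intro i
    rw [Function.apply_extend (fun v : X => ‖v‖ₑ ^ p)]
    congr 1
    ext
    simp [hp]
  simp only [strongNorm, this, tsum_extend_zero he]

lemma map_extend_zero {κ : Type*} (u : X →L[𝕜] Y) (e : ι → κ) (x : ι → X) :
    (fun i => u (Function.extend e x 0 i)) = Function.extend e (fun i => u (x i)) 0 := by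
  ext i
  rw [Function.apply_extend u]
  congr 1
  ext
  simp

lemma weakNorm_extend {p : ℝ} (hp : 0 < p) {κ : Type*} {e : ι → κ} (he : e.Injective)
    (x : ι → X) : weakNorm 𝕜 p (Function.extend e x 0) = weakNorm 𝕜 p x := by
  simp only [weakNorm, map_extend_zero, strongNorm_extend hp he]

/-- The inequality characterising absolutely summing operators. If it failed for every constant,
suitably scaled bad sequences could be put together into a single one. -/
lemma IsPSumming.exists_bound {p : ℝ} (hp : 1 ≤ p) {u : X →L[𝕜] Y} (hu : IsPSumming p u) :
    ∃ C : ℝ≥0, ∀ x : ℕ → X, strongNorm p (fun i => u (x i)) ≤ C * weakNorm 𝕜 p x := by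
  have hp0 : 0 < p := by linarith
  by_contra! h
  choose x hx using fun n : ℕ => h (2 ^ n)
  have hw : ∀ n, weakNorm 𝕜 p (x n) < ∞ := fun n => by
    refine lt_top_iff_ne_top.mpr fun h => ?_
    have := hx n
    rw [h, ENNReal.mul_top (by simp)] at this
    exact not_top_lt this
  have hs : ∀ n, strongNorm p (fun i => u (x n i)) ≠ ∞ := fun n => (hu _ (hw n)).ne
  have hs0 : ∀ n, strongNorm p (fun i => u (x n i)) ≠ 0 := fun n => (pos_of_gt (hx n)).ne'
  let t : ℕ → 𝕜 := fun n => ((strongNorm p fun i => u (x n i)).toReal⁻¹ : ℝ)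
  have ht : ∀ n, ‖t n‖ₑ = (strongNorm p fun i => u (x n i))⁻¹ := fun n => by
    have h1 : 0 < (strongNorm p fun i => u (x n i)).toReal := ENNReal.toReal_pos (hs0 n) (hs n)
    rw [← ofReal_norm, RCLike.norm_ofReal, abs_of_pos (inv_pos.mpr h1),
      ENNReal.ofReal_inv_of_pos h1, ENNReal.ofReal_toReal (hs n)]
  let y : ℕ × ℕ → X := fun a => t a.1 • x a.1 a.2
  have hyw : weakNorm 𝕜 p y < ∞ := by
    refine lt_of_le_of_lt (weakNorm_le hp0 (C := 2 ^ p⁻¹) fun φ hφ => ?_)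
      (ENNReal.rpow_lt_top_of_nonneg (by positivity) (by simp))
    rw [← ENNReal.rpow_mul, inv_mul_cancel₀ hp0.ne', ENNReal.rpow_one, ENNReal.tsum_prod',
      ← ENNReal.tsum_geometric_two]
    refine ENNReal.tsum_le_tsum fun n => ?_
    refine (tsum_le_weakNorm_rpow hp0 (fun i => t n • x n i) hφ).trans ?_
    have h1 : weakNorm 𝕜 p (fun i => t n • x n i) ≤ 2⁻¹ ^ n := by
      rw [weakNorm_smul hp0, ht, mul_comm, ← div_eq_mul_inv]
      refine ENNReal.div_le_of_le_mul ?_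
      have h2 := (hx n).le
      push_cast at h2
      rw [← ENNReal.inv_pow, mul_comm, ← div_eq_mul_inv,
        ENNReal.le_div_iff_mul_le (by simp) (by simp), mul_comm]
      exact h2
    refine (ENNReal.rpow_le_rpow h1 hp0.le).trans ?_
    refine ENNReal.rpow_le_self_of_le_one (pow_le_one₀ zero_le (by simp)) hp
  have hys : strongNorm p (fun a => u (y a)) = ∞ := by
    rw [strongNorm, ENNReal.tsum_prod']
    have : ∀ n, ∑' i, ‖u (y (n, i))‖ₑ ^ p = 1 := fun n => by
      have h1 := strongNorm_smul hp0 (t n) (fun i => u (x n i))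
      rw [ht, ENNReal.inv_mul_cancel (hs0 n) (hs n)] at h1
      simp only [y, map_smul]
      rw [← strongNorm_rpow hp0, h1, ENNReal.one_rpow]
    simp only [this]
    rw [ENNReal.tsum_const_eq_top_of_ne_zero one_ne_zero, ENNReal.top_rpow_of_pos (by positivity)]
  have he : Function.Injective (Nat.pairEquiv : ℕ × ℕ → ℕ) := Nat.pairEquiv.injective
  have := hu (Function.extend Nat.pairEquiv y 0) (by rwa [weakNorm_extend hp0 he])
  rw [map_extend_zero, strongNorm_extend hp0 he, hys] at this
  exact lt_irrefl _ this

/-- The inclusion theorem for absolutely summing operators. -/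
lemma IsPSumming.mono {p q : ℝ} (hp : 1 ≤ p) (hpq : p ≤ q) {u : X →L[𝕜] Y} (hu : IsPSumming p u) :
    IsPSumming q u := by
  rcases hpq.eq_or_lt with rfl | hpq
  · exact hu
  have hp0 : 0 < p := by linarith
  have hq0 : 0 < q := by linarith
  have hqp0 : 0 < q - p := by linarith
  obtain ⟨C, hC⟩ := hu.exists_bound hp
  intro x hx
  refine lt_of_le_of_lt ((strongNorm_le_iff hq0 (C := C * weakNorm 𝕜 q x)).mpr ?_)
    (ENNReal.mul_lt_top ENNReal.coe_lt_top hx)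
  rw [ENNReal.tsum_eq_iSup_sum]
  refine iSup_le fun s => ?_
  set A : ℝ≥0∞ := ∑ i ∈ s, ‖u (x i)‖ₑ ^ q with hA
  have hAtop : A ≠ ∞ := by
    refine (ENNReal.sum_lt_top.mpr fun i _ => ?_).ne
    exact ENNReal.rpow_lt_top_of_nonneg hq0.le enorm_ne_top
  rcases eq_or_ne A 0 with hA0 | hA0
  · rw [hA0]; exact zero_le
  -- the weights are chosen so that the `p`-sum of the weighted images is the `q`-sum of the images
  let c : ℕ → 𝕜 := fun i => if i ∈ s then ((‖u (x i)‖ ^ (q / p - 1) : ℝ) : 𝕜) else 0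
  have hc : ∀ i ∈ s, ‖c i‖ₑ ^ p = ‖u (x i)‖ₑ ^ (q - p) := fun i hi => by
    have h1 : 0 ≤ q / p - 1 := by rw [sub_nonneg, le_div_iff₀ hp0]; linarith
    simp only [c, if_pos hi]
    rw [← ofReal_norm, RCLike.norm_ofReal, abs_of_nonneg (by positivity),
      ← ENNReal.ofReal_rpow_of_nonneg (norm_nonneg _) h1, ofReal_norm, ← ENNReal.rpow_mul]
    congr 1
    field_simp
  have hc0 : ∀ i, i ∉ s → c i = 0 := fun i hi => by simp [c, hi]
  have hsum : ∀ v : ℕ → ℝ≥0∞,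
      ∑' i, (‖c i‖ₑ * v i) ^ p = ∑ i ∈ s, ‖u (x i)‖ₑ ^ (q - p) * v i ^ p := by
    intro v
    rw [tsum_eq_sum (s := s) (fun i hi => by simp [hc0 i hi, hp0])]
    refine Finset.sum_congr rfl fun i hi => ?_
    rw [ENNReal.mul_rpow_of_nonneg _ _ hp0.le, hc i hi]
  have hS : strongNorm p (fun i => u (c i • x i)) = A ^ (1 / p) := by
    simp only [map_smul, strongNorm, enorm_smul]
    rw [hsum, hA]
    congr 1
    refine Finset.sum_congr rfl fun i _ => ?_
    rw [← ENNReal.rpow_add_of_nonneg _ _ hqp0.le hp0.le, sub_add_cancel]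
  have hW : weakNorm 𝕜 p (fun i => c i • x i) ≤ A ^ (1 / p - 1 / q) * weakNorm 𝕜 q x := by
    refine weakNorm_le hp0 fun φ hφ => ?_
    simp only [map_smul, enorm_smul]
    rw [hsum]
    have hconj : (q / (q - p)).HolderConjugate (q / p) := by
      rw [Real.holderConjugate_iff]
      refine ⟨by rw [lt_div_iff₀ hqp0]; linarith, ?_⟩
      rw [inv_div, inv_div]; field_simp; ring
    refine (ENNReal.inner_le_Lp_mul_Lq s _ _ hconj).trans ?_
    rw [ENNReal.mul_rpow_of_nonneg _ _ hp0.le, ← ENNReal.rpow_mul]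
    have e1 : ∀ i, (‖u (x i)‖ₑ ^ (q - p)) ^ (q / (q - p)) = ‖u (x i)‖ₑ ^ q := fun i => by
      rw [← ENNReal.rpow_mul, mul_div_cancel₀ _ hqp0.ne']
    have e2 : ∀ i, (‖φ (x i)‖ₑ ^ p) ^ (q / p) = ‖φ (x i)‖ₑ ^ q := fun i => by
      rw [← ENNReal.rpow_mul, mul_div_cancel₀ _ hp0.ne']
    simp only [e1, e2]
    refine mul_le_mul' (le_of_eq ?_) ?_
    · rw [← hA]; congr 1; field_simp
    · have h1 := (ENNReal.sum_le_tsum s).trans (tsum_le_weakNorm_rpow (𝕜 := 𝕜) hq0 x hφ)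
      refine (ENNReal.rpow_le_rpow h1 (by positivity)).trans (le_of_eq ?_)
      rw [← ENNReal.rpow_mul]; congr 1; field_simp
  have h := hC (fun i => c i • x i)
  rw [hS] at h
  replace h : A ^ (1 / p) ≤ A ^ (1 / p - 1 / q) * (C * weakNorm 𝕜 q x) :=
    h.trans ((mul_le_mul_right hW _).trans (le_of_eq (mul_left_comm _ _ _)))
  have h1 : A ^ (1 / p) = A ^ (1 / p - 1 / q) * A ^ (1 / q) := by
    rw [← ENNReal.rpow_add _ _ hA0 hAtop, sub_add_cancel]
  have h2 : 0 < A ^ (1 / p - 1 / q) := ENNReal.rpow_pos (pos_iff_ne_zero.mpr hA0) hAtop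
  have h3 : A ^ (1 / p - 1 / q) ≠ ∞ := by
    refine (ENNReal.rpow_lt_top_of_nonneg ?_ hAtop).ne
    rw [sub_nonneg]
    exact one_div_le_one_div_of_le hp0 hpq.le
  rw [h1, ENNReal.mul_le_mul_iff_right h2.ne' h3] at h
  have h4 := ENNReal.rpow_le_rpow h hq0.le
  rwa [← ENNReal.rpow_mul, one_div_mul_cancel hq0.ne', ENNReal.rpow_one] at h4

lemma IsPSumming.clm_comp {Z : Type*} [NormedAddCommGroup Z] [NormedSpace 𝕜 Z] {p : ℝ} (hp : 0 < p)
    {u : X →L[𝕜] Y} (hu : IsPSumming p u) (v : Y →L[𝕜] Z) : IsPSumming p (v ∘L u) := by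
  intro x hx
  refine lt_of_le_of_lt ((strongNorm_le_iff hp
    (C := ‖v‖ₑ * strongNorm p fun i => u (x i))).mpr ?_) (ENNReal.mul_lt_top enorm_lt_top (hu x hx))
  rw [ENNReal.mul_rpow_of_nonneg _ _ hp.le, strongNorm_rpow hp, ← ENNReal.tsum_mul_left]
  refine ENNReal.tsum_le_tsum fun i => ?_
  rw [← ENNReal.mul_rpow_of_nonneg _ _ hp.le]
  exact ENNReal.rpow_le_rpow (v.le_opENorm _) hp.le

end Summing

/-! ### The distribution of the Rademacher functions -/

section Rademacher

lemma map_volume_two_mul_sub (b : ℝ) :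
    Measure.map (fun t : ℝ => 2 * t - b) volume = (2 : ℝ≥0∞)⁻¹ • volume := by
  have : (fun t : ℝ => 2 * t - b) = (fun t => t - b) ∘ (fun t => 2 * t) := rfl
  rw [this, ← Measure.map_map (by fun_prop) (by fun_prop), Real.map_volume_mul_left two_ne_zero,
    Measure.map_smul, map_sub_right_eq_self, abs_of_pos (by norm_num),
    ENNReal.ofReal_inv_of_pos two_pos, ENNReal.ofReal_ofNat]

lemma setLIntegral_two_mul_sub (b : ℝ) (G : ℝ → ℝ≥0∞) :
    ∫⁻ t in Set.Ico (b / 2) ((b + 1) / 2), G (2 * t - b) =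
      2⁻¹ * ∫⁻ t in Set.Ico (0 : ℝ) 1, G t := by
  have hemb : MeasurableEmbedding (fun t : ℝ => 2 * t - b) :=
    ((Homeomorph.mulLeft₀ (2 : ℝ) two_ne_zero).trans (Homeomorph.subRight b)).measurableEmbedding
  have hpre : (fun t : ℝ => 2 * t - b) ⁻¹' Set.Ico 0 1 = Set.Ico (b / 2) ((b + 1) / 2) := by
    ext t
    simp only [Set.mem_preimage, Set.mem_Ico]
    constructor <;> rintro ⟨h1, h2⟩ <;> constructor <;> linarith
  rw [← hpre, ← hemb.lintegral_map G, ← hemb.restrict_map, map_volume_two_mul_sub,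
    Measure.restrict_smul, lintegral_smul_measure, smul_eq_mul]

lemma rademacher_one_of_lt {t : ℝ} (h0 : 0 ≤ t) (h : t < 1 / 2) : rademacher 1 t = 1 := by
  have : ⌊(2 : ℝ) ^ 1 * t⌋ = 0 := by
    rw [Int.floor_eq_iff]; constructor <;> push_cast <;> linarith
  rw [rademacher, this]; simp

lemma rademacher_one_of_ge {t : ℝ} (h0 : 1 / 2 ≤ t) (h : t < 1) : rademacher 1 t = -1 := by
  have : ⌊(2 : ℝ) ^ 1 * t⌋ = 1 := by
    rw [Int.floor_eq_iff]; constructor <;> push_cast <;> linarith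
  rw [rademacher, this]; simp

lemma rademacher_succ (n : ℕ) (t : ℝ) : rademacher (n + 1) t = rademacher n (2 * t) := by
  simp only [rademacher, pow_succ, mul_assoc]

lemma rademacher_succ_sub_one (n : ℕ) (t : ℝ) :
    rademacher (n + 1) (t - 1) = rademacher (n + 1) t := by
  have : (2 : ℝ) ^ (n + 1) * (t - 1) = 2 ^ (n + 1) * t - ((2 ^ (n + 1) : ℤ) : ℝ) := by
    push_cast; ring
  have he : Even ((2 : ℤ) ^ (n + 1)) := ⟨2 ^ n, by ring⟩
  simp only [rademacher, this, Int.floor_sub_intCast, Int.even_sub, he, iff_true]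

lemma sum_fin_succ_signs {M : Type*} [AddCommMonoid M] (m : ℕ) (F : (Fin (m + 1) → ℤˣ) → M) :
    ∑ s, F s = ∑ s : Fin m → ℤˣ, F (Fin.cons 1 s) + ∑ s : Fin m → ℤˣ, F (Fin.cons (-1) s) := by
  rw [← (Fin.consEquiv fun _ : Fin (m + 1) => ℤˣ).sum_comp, Fintype.sum_prod_type]
  simp [Fin.consEquiv, UnitsInt.univ]

/-- The first `m` Rademacher functions are distributed as independent signs. -/
lemma lintegral_rademacher (m : ℕ) (F : (Fin m → ℤ) → ℝ≥0∞) :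
    ∫⁻ t in Set.Icc (0 : ℝ) 1, F (fun i => rademacher ((i : ℕ) + 1) t) =
      (2 ^ m)⁻¹ * ∑ s : Fin m → ℤˣ, F fun i => (s i : ℤ) := by
  rw [← setLIntegral_congr Ico_ae_eq_Icc]
  induction m with
  | zero =>
    obtain ⟨c, rfl⟩ : ∃ c, F = fun _ => c :=
      ⟨F 0, funext fun a => congrArg F (Subsingleton.elim a 0)⟩
    simp
  | succ m ih =>
    -- halving the interval fixes the first function and turns the others into `m` such functions
    have hU : Set.Ico (0 : ℝ) 1 =
        Set.Ico (0 / 2 : ℝ) ((0 + 1) / 2) ∪ Set.Ico (1 / 2) ((1 + 1) / 2) := by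
      norm_num [Set.Ico_union_Ico_eq_Ico]
    rw [hU, lintegral_union measurableSet_Ico (by
      rw [Set.Ico_disjoint_Ico]; norm_num)]
    have h1 : ∫⁻ t in Set.Ico (0 / 2 : ℝ) ((0 + 1) / 2), F (fun i => rademacher ((i : ℕ) + 1) t) =
        2⁻¹ * ∫⁻ t in Set.Ico (0 : ℝ) 1,
          F (Fin.cons 1 fun i : Fin m => rademacher ((i : ℕ) + 1) t) := by
      rw [← setLIntegral_two_mul_sub 0 fun t =>
        F (Fin.cons 1 fun i : Fin m => rademacher ((i : ℕ) + 1) t)]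
      refine setLIntegral_congr_fun measurableSet_Ico fun t ht => ?_
      congr 1
      ext i
      refine Fin.cases ?_ (fun i => ?_) i
      · simpa using rademacher_one_of_lt (by linarith [ht.1]) (by linarith [ht.2])
      · simp [rademacher_succ ((i : ℕ) + 1)]
    have h2 : ∫⁻ t in Set.Ico (1 / 2 : ℝ) ((1 + 1) / 2), F (fun i => rademacher ((i : ℕ) + 1) t) =
        2⁻¹ * ∫⁻ t in Set.Ico (0 : ℝ) 1,
          F (Fin.cons (-1) fun i : Fin m => rademacher ((i : ℕ) + 1) t) := by
      rw [← setLIntegral_two_mul_sub 1 fun t =>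
        F (Fin.cons (-1) fun i : Fin m => rademacher ((i : ℕ) + 1) t)]
      refine setLIntegral_congr_fun measurableSet_Ico fun t ht => ?_
      congr 1
      ext i
      refine Fin.cases ?_ (fun i => ?_) i
      · simpa using rademacher_one_of_ge ht.1 (by linarith [ht.2])
      · simp [rademacher_succ ((i : ℕ) + 1), rademacher_succ_sub_one]
    rw [h1, h2, ih fun a => F (Fin.cons 1 a), ih fun a => F (Fin.cons (-1) a), sum_fin_succ_signs,
      ← mul_add, ← mul_add, ← mul_assoc, pow_succ,
      ENNReal.mul_inv (Or.inr (by simp)) (Or.inr (by simp)), mul_comm (2⁻¹ : ℝ≥0∞)]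
    have e : ∀ (a : ℤˣ) (s : Fin m → ℤˣ),
        (Fin.cons (a : ℤ) fun i => (s i : ℤ) : Fin (m + 1) → ℤ) =
          fun i => (((Fin.cons a s : Fin (m + 1) → ℤˣ) i : ℤˣ) : ℤ) := fun a s => by
      ext i
      refine Fin.cases ?_ (fun i => ?_) i <;> simp
    have e1 := e 1
    have e2 := e (-1)
    simp only [Units.val_one, Units.val_neg] at e1 e2
    simp only [e1, e2]

end Rademacher

/-! ### Almost summing operators -/

section AlmostSumming

variable {𝕜 X Y : Type*} [RCLike 𝕜] [NormedAddCommGroup X] [NormedSpace 𝕜 X]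
  [NormedAddCommGroup Y] [NormedSpace 𝕜 Y]

lemma radNorm_eq_sum {m : ℕ} (y : Fin m → Y) :
    radNorm y = ((2 ^ m)⁻¹ * ∑ s : Fin m → ℤˣ, ‖∑ i, (s i : ℤ) • y i‖ₑ ^ 2) ^ (1 / 2 : ℝ) := by
  rw [radNorm, ← lintegral_rademacher m fun a => ‖∑ i, a i • y i‖ₑ ^ 2]

lemma radNorm_clm_le {m : ℕ} (v : X →L[𝕜] Y) (y : Fin m → X) :
    radNorm (fun i => v (y i)) ≤ ‖v‖ₑ * radNorm y := by
  have e : ∀ s : Fin m → ℤˣ, ‖∑ i, (s i : ℤ) • v (y i)‖ₑ ≤ ‖v‖ₑ * ‖∑ i, (s i : ℤ) • y i‖ₑ :=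
    fun s => by
      have : ∑ i, (s i : ℤ) • v (y i) = v (∑ i, (s i : ℤ) • y i) := by simp
      rw [this]; exact v.le_opENorm _
  have h2 : ‖v‖ₑ = (‖v‖ₑ ^ 2) ^ (1 / 2 : ℝ) := by
    rw [← ENNReal.rpow_natCast, ← ENNReal.rpow_mul]; simp
  rw [radNorm_eq_sum, radNorm_eq_sum, h2, ← ENNReal.mul_rpow_of_nonneg _ _ (by norm_num),
    mul_left_comm]
  refine ENNReal.rpow_le_rpow (mul_le_mul_right ?_ _) (by norm_num)
  rw [Finset.mul_sum]
  refine Finset.sum_le_sum fun s _ => ?_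
  rw [← mul_pow]
  exact pow_le_pow_left' (e s) 2

lemma radNorm_add_le {m : ℕ} (y z : Fin m → Y) :
    radNorm (fun i => y i + z i) ≤ radNorm y + radNorm z := by
  simp only [radNorm_eq_sum, ENNReal.mul_rpow_of_nonneg _ _ (by norm_num : (0 : ℝ) ≤ 1 / 2)]
  rw [← mul_add]
  gcongr
  have h := ENNReal.Lp_add_le Finset.univ (fun s : Fin m → ℤˣ => ‖∑ i, (s i : ℤ) • y i‖ₑ)
    (fun s => ‖∑ i, (s i : ℤ) • z i‖ₑ) (p := 2) (by norm_num)
  simp only [ENNReal.rpow_two] at h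
  refine le_trans ?_ h
  gcongr with s
  simp only [smul_add, Finset.sum_add_distrib]
  exact enorm_add_le _ _

lemma tendsto_radNorm {T : Type*} {l : Filter T} {m : ℕ} {f : T → Fin m → Y} {y : Fin m → Y}
    (h : ∀ i, Tendsto (fun t => f t i) l (𝓝 (y i))) :
    Tendsto (fun t => radNorm (f t)) l (𝓝 (radNorm y)) := by
  simp only [radNorm_eq_sum]
  refine (ENNReal.continuous_rpow_const.tendsto _).comp ?_
  refine ENNReal.Tendsto.const_mul ?_ (Or.inr (by simp))
  refine tendsto_finsetSum _ fun s _ => ?_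
  refine ((ENNReal.continuous_pow 2).tendsto _).comp ?_
  exact (tendsto_finsetSum _ fun i _ => (h i).const_smul _).enorm

lemma radNorm_fin_one (y : Y) : radNorm (fun _ : Fin 1 => y) = ‖y‖ₑ := by
  have e : ∀ s : Fin 1 → ℤˣ, ‖(s 0 : ℤ) • y‖ₑ = ‖y‖ₑ := fun s => by
    rcases Int.units_eq_one_or (s 0) with h | h <;> simp [h]
  rw [radNorm_eq_sum]
  simp only [Fin.sum_univ_one, Fin.isValue, e, Finset.sum_const, Finset.card_univ, nsmul_eq_mul]
  rw [← mul_assoc]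
  have : ((2 : ℝ≥0∞) ^ 1)⁻¹ * ((Fintype.card (Fin 1 → ℤˣ) : ℕ) : ℝ≥0∞) = 1 := by
    simp [ENNReal.inv_mul_cancel]
  rw [this, one_mul, ← ENNReal.rpow_natCast, ← ENNReal.rpow_mul]
  simp

lemma weakNorm_ne_top {p : ℝ} (hp : 0 < p) {m : ℕ} (x : Fin m → X) : weakNorm 𝕜 p x ≠ ∞ := by
  refine ne_top_of_le_ne_top (b := strongNorm p x) ?_ (weakNorm_le hp fun φ hφ => ?_)
  · rw [strongNorm, tsum_fintype]
    exact (ENNReal.rpow_lt_top_of_nonneg (by positivity) (ENNReal.sum_lt_top.mpr fun i _ =>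
      ENNReal.rpow_lt_top_of_nonneg hp.le enorm_ne_top).ne).ne
  · rw [strongNorm_rpow hp]
    refine ENNReal.tsum_le_tsum fun i => ENNReal.rpow_le_rpow ?_ hp.le
    refine (φ.le_opENorm _).trans (mul_le_of_le_one_left zero_le ?_)
    rw [← ofReal_norm]
    exact ENNReal.ofReal_le_one.mpr hφ

lemma AlmostSummingBound.norm_le {u : X →L[𝕜] Y} {C : ℝ≥0} (h : AlmostSummingBound u C) :
    ‖u‖ ≤ C := by
  refine u.opNorm_le_bound C.2 fun x => ?_
  have h1 := h 1 fun _ => x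
  rw [radNorm_fin_one] at h1
  have h2 : weakNorm 𝕜 2 (fun _ : Fin 1 => x) ≤ ‖x‖ₑ := by
    refine weakNorm_le two_pos fun φ hφ => ?_
    rw [tsum_fintype, Fin.sum_univ_one]
    refine ENNReal.rpow_le_rpow ?_ two_pos.le
    refine (φ.le_opENorm _).trans (mul_le_of_le_one_left zero_le ?_)
    rw [← ofReal_norm]
    exact ENNReal.ofReal_le_one.mpr hφ
  have h3 : ‖u x‖ₑ ≤ C * ‖x‖ₑ := h1.trans (by gcongr)
  simpa [enorm_eq_nnnorm, ← ENNReal.coe_mul, ← NNReal.coe_le_coe] using h3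

lemma AlmostSummingBound.mono {u : X →L[𝕜] Y} {C D : ℝ≥0} (h : AlmostSummingBound u C)
    (hCD : C ≤ D) : AlmostSummingBound u D := fun m x =>
  (h m x).trans (by gcongr)

lemma AlmostSummingBound.clm_comp {Z : Type*} [NormedAddCommGroup Z] [NormedSpace 𝕜 Z]
    {u : X →L[𝕜] Y} {C : ℝ≥0} (h : AlmostSummingBound u C) (v : Y →L[𝕜] Z) :
    AlmostSummingBound (v ∘L u) (‖v‖₊ * C) := fun m x => by
  refine (radNorm_clm_le v fun i => u (x i)).trans ?_
  rw [ENNReal.coe_mul, mul_assoc, enorm_eq_nnnorm]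
  exact mul_le_mul_right (h m x) _

lemma AlmostSummingBound.sum {κ : Type*} (s : Finset κ) {u : κ → X →L[𝕜] Y} {C : κ → ℝ≥0}
    (h : ∀ k ∈ s, AlmostSummingBound (u k) (C k)) :
    AlmostSummingBound (∑ k ∈ s, u k) (∑ k ∈ s, C k) := by
  classical
  induction s using Finset.induction_on with
  | empty =>
    intro m x
    simp [radNorm_eq_sum]
  | insert a s ha ih =>
    intro m x
    rw [Finset.sum_insert ha, Finset.sum_insert ha, ENNReal.coe_add, add_mul]
    exact (radNorm_add_le _ _).trans (add_le_add (h a (Finset.mem_insert_self _ _) m x)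
      (ih (fun k hk => h k (Finset.mem_insert_of_mem hk)) m x))

/-- Lower semicontinuity of the almost summing norm. -/
lemma AlmostSummingBound.of_tendsto {T : Type*} {l : Filter T} [l.NeBot] {f : T → X →L[𝕜] Y}
    {u : X →L[𝕜] Y} (hf : Tendsto f l (𝓝 u)) {C : ℝ≥0} (h : ∀ t, AlmostSummingBound (f t) C) :
    AlmostSummingBound u C := fun m x => by
  have h1 : Tendsto (fun t => radNorm fun i => f t (x i)) l (𝓝 (radNorm fun i => u (x i))) :=
    tendsto_radNorm fun i =>
      ((ContinuousLinearMap.apply 𝕜 Y (x i)).continuous.tendsto u).comp hf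
  exact le_of_tendsto h1 (Eventually.of_forall fun t => h t m x)

lemma AlmostSummingBound.hasSum {κ : Type*} {u : κ → X →L[𝕜] Y} {T : X →L[𝕜] Y} (hT : HasSum u T)
    {C : κ → ℝ≥0} (hC : Summable C) (h : ∀ k, AlmostSummingBound (u k) (C k)) :
    AlmostSummingBound T (∑' k, C k) :=
  have hT' : Tendsto (fun s : Finset κ => ∑ k ∈ s, u k) atTop (𝓝 T) := hT
  .of_tendsto hT' fun s => (AlmostSummingBound.sum s fun k _ => h k).mono
    (hC.sum_le_tsum s fun _ _ => zero_le)

lemma almostSummingNorm_le {u : X →L[𝕜] Y} {C : ℝ≥0} (h : AlmostSummingBound u C) :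
    almostSummingNorm u ≤ C := csInf_le (OrderBot.bddBelow _) h

/-- The infimum defining the almost summing norm is attained. -/
lemma IsAlmostSumming.bound {u : X →L[𝕜] Y} (hu : IsAlmostSumming u) :
    AlmostSummingBound u (almostSummingNorm u) := by
  intro m x
  have hW := weakNorm_ne_top (𝕜 := 𝕜) two_pos x
  rcases eq_or_ne (weakNorm 𝕜 2 x) 0 with h0 | h0
  · obtain ⟨C, hC⟩ := hu
    have := hC m x
    rw [h0, mul_zero] at this ⊢
    exact this
  · rw [← ENNReal.div_le_iff h0 hW]
    have hle : ∀ C : ℝ≥0, AlmostSummingBound u C →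
        radNorm (fun i => u (x i)) / weakNorm 𝕜 2 x ≤ C := fun C hC =>
      (ENNReal.div_le_iff h0 hW).mpr (hC m x)
    obtain ⟨C, hC⟩ := hu
    have hfin : radNorm (fun i => u (x i)) / weakNorm 𝕜 2 x ≠ ∞ :=
      ne_top_of_le_ne_top ENNReal.coe_ne_top (hle C hC)
    rw [← ENNReal.coe_toNNReal hfin, ENNReal.coe_le_coe]
    refine le_csInf ⟨C, hC⟩ fun D hD => ?_
    rw [← ENNReal.coe_le_coe, ENNReal.coe_toNNReal hfin]
    exact hle D hD

lemma IsAlmostSumming.norm_le {u : X →L[𝕜] Y} (hu : IsAlmostSumming u) :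
    ‖u‖ ≤ almostSummingNorm u := hu.bound.norm_le

end AlmostSumming

/-! ### Signed sums with prescribed truncated moments -/

lemma expect_mul_le_Lp_mul_Lq {Ω : Type*} [Fintype Ω] {p q : ℝ} (hpq : p.HolderConjugate q)
    {f g : Ω → ℝ} (hf : ∀ ω, 0 ≤ f ω) (hg : ∀ ω, 0 ≤ g ω) :
    𝔼 ω, f ω * g ω ≤ (𝔼 ω, f ω ^ p) ^ (1 / p) * (𝔼 ω, g ω ^ q) ^ (1 / q) := by
  have hN : (0 : ℝ) ≤ Fintype.card Ω := Nat.cast_nonneg _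
  simp only [Fintype.expect_eq_sum_div_card]
  rw [Real.div_rpow (Finset.sum_nonneg fun i _ => Real.rpow_nonneg (hf i) _) hN,
    Real.div_rpow (Finset.sum_nonneg fun i _ => Real.rpow_nonneg (hg i) _) hN, div_mul_div_comm,
    ← Real.rpow_add_of_nonneg hN (by simpa using hpq.nonneg) (by simpa using hpq.symm.nonneg)]
  have h1 : 1 / p + 1 / q = 1 := by simpa using hpq.inv_add_inv_eq_one
  rw [h1, Real.rpow_one]
  gcongr
  exact Real.inner_le_Lp_mul_Lq_of_nonneg _ hpq (fun i _ => hf i) (fun i _ => hg i)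

lemma expect_rpow_le {Ω : Type*} [Fintype Ω] [Nonempty Ω] {p : ℝ} (hp : 1 ≤ p)
    {f : Ω → ℝ} (hf : ∀ ω, 0 ≤ f ω) : (𝔼 ω, f ω) ^ p ≤ 𝔼 ω, f ω ^ p := by
  have h := Real.rpow_arith_mean_le_arith_mean_rpow Finset.univ
    (fun _ : Ω => (Fintype.card Ω : ℝ)⁻¹) f (fun _ _ => by positivity) (by simp)
    (fun i _ => hf i) hp
  simpa [Fintype.expect_eq_sum_div_card, ← Finset.mul_sum, div_eq_inv_mul] using h

lemma expect_nonneg_of {Ω : Type*} [Fintype Ω] {f : Ω → ℝ} (hf : ∀ ω, 0 ≤ f ω) :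
    0 ≤ 𝔼 ω, f ω := Finset.expect_nonneg fun i _ => hf i

section Signs

variable {𝕜 : Type*} [RCLike 𝕜] {ι : Type*} [Fintype ι]

/-- The dual form of Hölder's inequality for finite families of scalars. -/
lemma Lq_le_of_forall_pairing_le {α q : ℝ} (hαq : α.HolderConjugate q) {b : ι → 𝕜} {B : ℝ}
    (h : ∀ a : ι → 𝕜, ∑ i, ‖a i‖ ^ α ≤ 1 → ‖∑ i, a i * b i‖ ≤ B) :
    (∑ i, ‖b i‖ ^ q) ^ (1 / q) ≤ B := by
  obtain ⟨g, hg, hgb⟩ := (NNReal.isGreatest_Lp Finset.univ (fun i => ‖b i‖₊) hαq.symm).1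
  -- multiplying the extremal coefficients by phases makes every product `a i * b i` nonnegative
  let a : ι → 𝕜 := fun i => ((g i : ℝ) : 𝕜) * ((starRingEnd 𝕜) (b i) * ((‖b i‖ : 𝕜))⁻¹)
  have hab : ∀ i, a i * b i = ((‖b i‖ * g i : ℝ) : 𝕜) := fun i => by
    rcases eq_or_ne (b i) 0 with h0 | h0
    · simp [a, h0]
    · have h1 : (‖b i‖ : 𝕜) ≠ 0 := by simpa using h0
      have h2 := RCLike.conj_mul (b i)
      simp only [a]
      push_cast
      field_simp
      rw [mul_assoc, h2]
  have ha : ∀ i, ‖a i‖ ≤ g i := fun i => by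
    simp only [a, norm_mul, norm_inv, RCLike.norm_conj, RCLike.norm_ofReal, abs_norm, NNReal.abs_eq]
    exact mul_le_of_le_one_right (g i).2 mul_inv_le_one
  have h1 : ∑ i, ‖a i‖ ^ α ≤ 1 := by
    refine (Finset.sum_le_sum fun i _ =>
      Real.rpow_le_rpow (norm_nonneg _) (ha i) hαq.nonneg).trans ?_
    have : ∑ i, g i ^ α ≤ 1 := hg
    exact_mod_cast this
  have h2 := h a h1
  simp only [hab] at h2
  rw [← RCLike.ofReal_sum, RCLike.norm_ofReal] at h2
  have h3 : ∑ i, ‖b i‖ * (g i : ℝ) = (∑ i, ‖b i‖ ^ q) ^ (1 / q) := by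
    have := congrArg NNReal.toReal hgb
    simpa using this
  rw [← h3]
  exact (le_abs_self _).trans h2

lemma rpow_sum_sq_le_sum_rpow {β : ℝ} (hβ : 0 < β) (hβ2 : β ≤ 2) {x : ι → ℝ} (hx : ∀ i, 0 ≤ x i) :
    (∑ i, x i ^ 2) ^ (β / 2) ≤ ∑ i, x i ^ β := by
  have e : ∀ i, x i ^ β = (x i ^ 2) ^ (β / 2) := fun i => by
    rw [← Real.rpow_natCast, ← Real.rpow_mul (hx i)]; congr 1; push_cast; ring
  simp only [e]
  classical
  have : ∀ S : Finset ι, (∑ i ∈ S, x i ^ 2) ^ (β / 2) ≤ ∑ i ∈ S, (x i ^ 2) ^ (β / 2) := by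
    intro S
    induction S using Finset.induction_on with
    | empty => simp [Real.zero_rpow (by positivity : β / 2 ≠ 0)]
    | insert a S ha ih =>
      rw [Finset.sum_insert ha, Finset.sum_insert ha]
      exact (Real.rpow_add_le_add_rpow (by positivity) (Finset.sum_nonneg fun _ _ => by positivity)
        (by positivity) (by linarith)).trans (by gcongr)
  exact this _

variable [DecidableEq ι]

lemma signUnit_mul_self (e : ℤˣ) : ((e : ℤ) : 𝕜) * ((e : ℤ) : 𝕜) = 1 := by
  rcases Int.units_eq_one_or e with h | h <;> simp [h]

lemma norm_signUnit (e : ℤˣ) : ‖((e : ℤ) : 𝕜)‖ = 1 := by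
  rcases Int.units_eq_one_or e with h | h <;> simp [h]

/-- Flipping one sign shows that an average which is odd in that sign vanishes. -/
lemma expect_sign_mul_eq_zero (i : ι) (F : (ι → ℤˣ) → 𝕜)
    (hF : ∀ s, F (Function.update s i (-s i)) = F s) :
    𝔼 s : ι → ℤˣ, ((s i : ℤ) : 𝕜) * F s = 0 := by
  let e : (ι → ℤˣ) ≃ (ι → ℤˣ) :=
    Function.Involutive.toPerm (fun s => Function.update s i (-s i)) (fun s => by simp)
  have h : 𝔼 s : ι → ℤˣ, ((s i : ℤ) : 𝕜) * F s = 𝔼 s : ι → ℤˣ, -(((s i : ℤ) : 𝕜) * F s) :=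
    Fintype.expect_equiv e _ _ fun s => by
      simp [e, Function.Involutive.toPerm, hF]
  rw [Finset.expect_neg_distrib] at h
  exact self_eq_neg.mp h

lemma expect_sign_mul_sign (i j : ι) :
    𝔼 s : ι → ℤˣ, ((s i : ℤ) : 𝕜) * ((s j : ℤ) : 𝕜) = if i = j then 1 else 0 := by
  split_ifs with h
  · subst h
    simp [signUnit_mul_self]
  · exact expect_sign_mul_eq_zero i _ fun s => by simp [Ne.symm h]

lemma expect_norm_sign_sum_sq (c : ι → 𝕜) :
    𝔼 s : ι → ℤˣ, ‖∑ i, ((s i : ℤ) : 𝕜) * c i‖ ^ 2 = ∑ i, ‖c i‖ ^ 2 := by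
  apply RCLike.ofReal_injective (K := 𝕜)
  have key : ∀ s : ι → ℤˣ, ((‖∑ i, ((s i : ℤ) : 𝕜) * c i‖ ^ 2 : ℝ) : 𝕜) =
      ∑ i, ∑ j, (((s i : ℤ) : 𝕜) * ((s j : ℤ) : 𝕜)) * (c i * (starRingEnd 𝕜) (c j)) := by
    intro s
    rw [RCLike.ofReal_pow, ← RCLike.mul_conj, map_sum, Finset.sum_mul_sum]
    refine Finset.sum_congr rfl fun i _ => Finset.sum_congr rfl fun j _ => ?_
    simp only [map_mul, map_intCast]
    ring
  rw [RCLike.ofReal_expect]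
  simp only [key, Finset.expect_sum_comm, ← Finset.expect_mul, expect_sign_mul_sign, ite_mul,
    one_mul, zero_mul, Finset.sum_ite_eq, Finset.mem_univ, if_true, RCLike.mul_conj]
  push_cast
  rfl

/-- Between `L²` and `L^β` with `β ≤ 2`, the average over the signs is controlled by the
square function. -/
lemma expect_norm_sign_sum_rpow_le {β : ℝ} (hβ : 0 < β) (hβ2 : β ≤ 2) (c : ι → 𝕜) :
    𝔼 s : ι → ℤˣ, ‖∑ i, ((s i : ℤ) : 𝕜) * c i‖ ^ β ≤ (∑ i, ‖c i‖ ^ 2) ^ (β / 2) := by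
  have h := expect_rpow_le (Ω := ι → ℤˣ) (p := 2 / β) (by rwa [le_div_iff₀ hβ, one_mul])
    (f := fun s => ‖∑ i, ((s i : ℤ) : 𝕜) * c i‖ ^ β) (fun s => by positivity)
  have e : ∀ x : ℝ, 0 ≤ x → (x ^ β) ^ (2 / β) = x ^ 2 := fun x hx => by
    rw [← Real.rpow_mul hx, mul_div_cancel₀ _ hβ.ne']; norm_cast
  simp only [e _ (norm_nonneg _), expect_norm_sign_sum_sq] at h
  have h0 : 0 ≤ 𝔼 s : ι → ℤˣ, ‖∑ i, ((s i : ℤ) : 𝕜) * c i‖ ^ β :=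
    expect_nonneg_of fun _ => by positivity
  have := Real.rpow_le_rpow (by positivity) h (z := β / 2) (by positivity)
  rwa [← Real.rpow_mul h0, div_mul_div_cancel₀ hβ.ne', div_self two_ne_zero, Real.rpow_one] at this

variable {Ω : Type*} [Fintype Ω]

lemma Lp_sign_sum_le_of_rpow {β A : ℝ} (hβ : 0 < β) (hβ2 : β ≤ 2) {c : ι → Ω → 𝕜}
    (h : ∑ i, 𝔼 ω, ‖c i ω‖ ^ β ≤ A) :
    (𝔼 z : Ω × (ι → ℤˣ), ‖∑ i, ((z.2 i : ℤ) : 𝕜) * c i z.1‖ ^ β) ^ (1 / β) ≤ A ^ (1 / β) := by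
  refine Real.rpow_le_rpow (expect_nonneg_of fun _ => by positivity) ?_ (by positivity)
  rw [← Finset.univ_product_univ, Finset.expect_product]
  have h1 : ∀ ω : Ω, 𝔼 s : ι → ℤˣ, ‖∑ i, ((s i : ℤ) : 𝕜) * c i ω‖ ^ β ≤ ∑ i, ‖c i ω‖ ^ β :=
    fun ω => (expect_norm_sign_sum_rpow_le hβ hβ2 _).trans
      (rpow_sum_sq_le_sum_rpow hβ hβ2 fun i => norm_nonneg _)
  have h2 : 𝔼 ω : Ω, ∑ i, ‖c i ω‖ ^ β = ∑ i, 𝔼 ω, ‖c i ω‖ ^ β :=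
    Finset.expect_sum_comm _ _ _
  exact (Finset.expect_le_expect fun ω _ => h1 ω).trans (h2.trans_le h)

variable [Nonempty Ω]

lemma Lp_sign_sum_le_of_sq {β A : ℝ} (hβ : 0 < β) (hβ2 : β ≤ 2) {c : ι → Ω → 𝕜}
    (h : ∑ i, 𝔼 ω, ‖c i ω‖ ^ 2 ≤ A) :
    (𝔼 z : Ω × (ι → ℤˣ), ‖∑ i, ((z.2 i : ℤ) : 𝕜) * c i z.1‖ ^ β) ^ (1 / β) ≤ A ^ (1 / 2 : ℝ) := by
  rw [← Finset.univ_product_univ, Finset.expect_product]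
  have h1 : 𝔼 ω : Ω, 𝔼 s : ι → ℤˣ, ‖∑ i, ((s i : ℤ) : 𝕜) * c i ω‖ ^ β ≤
      𝔼 ω : Ω, (∑ i, ‖c i ω‖ ^ 2) ^ (β / 2) :=
    Finset.expect_le_expect fun ω _ => expect_norm_sign_sum_rpow_le hβ hβ2 _
  have h2 := expect_rpow_le (Ω := Ω) (p := 2 / β) (by rwa [le_div_iff₀ hβ, one_mul])
    (f := fun ω => (∑ i, ‖c i ω‖ ^ 2) ^ (β / 2)) (fun s => by positivity)
  have e : ∀ x : ℝ, 0 ≤ x → (x ^ (β / 2)) ^ (2 / β) = x := fun x hx => by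
    rw [← Real.rpow_mul hx, div_mul_div_cancel₀ two_ne_zero, div_self hβ.ne', Real.rpow_one]
  have h3 : 𝔼 ω : Ω, ((∑ i, ‖c i ω‖ ^ 2) ^ (β / 2)) ^ (2 / β) ≤ A := by
    simp only [e _ (Finset.sum_nonneg fun i _ => sq_nonneg ‖c i _‖), Finset.expect_sum_comm]
    exact h
  have h0 : 0 ≤ 𝔼 ω : Ω, (∑ i, ‖c i ω‖ ^ 2) ^ (β / 2) := expect_nonneg_of fun _ => by positivity
  calc _ ≤ (𝔼 ω : Ω, (∑ i, ‖c i ω‖ ^ 2) ^ (β / 2)) ^ (1 / β) :=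
        Real.rpow_le_rpow (expect_nonneg_of fun _ => expect_nonneg_of fun _ => by positivity) h1
          (by positivity)
    _ = ((𝔼 ω : Ω, (∑ i, ‖c i ω‖ ^ 2) ^ (β / 2)) ^ (2 / β)) ^ (1 / 2 : ℝ) := by
        rw [← Real.rpow_mul h0]; congr 1; field_simp
    _ ≤ _ := Real.rpow_le_rpow (by positivity) (h2.trans h3) (by norm_num)

lemma norm_expect_mul_le {β r : ℝ} (hβr : β.HolderConjugate r) {Z : Type*} [Fintype Z]
    (g P : Z → 𝕜) :
    ‖𝔼 z, g z * P z‖ ≤ (𝔼 z, ‖P z‖ ^ β) ^ (1 / β) * (𝔼 z, ‖g z‖ ^ r) ^ (1 / r) := by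
  refine le_trans ?_ (expect_mul_le_Lp_mul_Lq hβr (fun z => norm_nonneg (P z))
    (fun z => norm_nonneg (g z)))
  rw [Fintype.expect_eq_sum_div_card, Fintype.expect_eq_sum_div_card, norm_div, RCLike.norm_natCast]
  gcongr
  refine (norm_sum_le _ _).trans (Finset.sum_le_sum fun z _ => ?_)
  rw [norm_mul, mul_comm]

/-- The estimate that makes signed functions `s i * v i` behave like independent `α`-stable
variables: they span a copy of `ℓ_α` in `L^β` as far as the upper bound is concerned. It is stated
in the dual form, for the coefficients of a function `g`. -/
lemma sign_coeff_pairing_le {α β r A : ℝ} (hβr : β.HolderConjugate r)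
    (hβ2 : β ≤ 2) (hA : 0 ≤ A) {v : ι → Ω → ℝ}
    (hv : ∀ i ω, 0 ≤ v i ω)
    (hsmall : ∀ i t, 0 < t → 𝔼 ω, (if v i ω ≤ t then v i ω ^ 2 else 0) ≤ A * t ^ (2 - α))
    (hlarge : ∀ i t, 0 < t → 𝔼 ω, (if v i ω ≤ t then 0 else v i ω ^ β) ≤ A * t ^ (β - α))
    (g : Ω × (ι → ℤˣ) → 𝕜) {a : ι → 𝕜} (ha : ∑ i, ‖a i‖ ^ α ≤ 1) :
    ‖∑ i, a i * 𝔼 z : Ω × (ι → ℤˣ), g z * (((z.2 i : ℤ) : 𝕜) * (v i z.1 : 𝕜))‖ ≤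
      (A ^ (1 / 2 : ℝ) + A ^ (1 / β)) * (𝔼 z, ‖g z‖ ^ r) ^ (1 / r) := by
  -- the summand `a i * v i` is truncated at height `1`
  let c₁ : ι → Ω → 𝕜 := fun i ω => if ‖a i‖ * v i ω ≤ 1 then a i * (v i ω : 𝕜) else 0
  let c₂ : ι → Ω → 𝕜 := fun i ω => if ‖a i‖ * v i ω ≤ 1 then 0 else a i * (v i ω : 𝕜)
  have hc : ∀ i ω, a i * (v i ω : 𝕜) = c₁ i ω + c₂ i ω := fun i ω => by
    simp only [c₁, c₂]; split_ifs <;> simp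
  have hsplit : ∑ i, a i * 𝔼 z : Ω × (ι → ℤˣ), g z * (((z.2 i : ℤ) : 𝕜) * (v i z.1 : 𝕜)) =
      (𝔼 z : Ω × (ι → ℤˣ), g z * ∑ i, ((z.2 i : ℤ) : 𝕜) * c₁ i z.1) +
      𝔼 z : Ω × (ι → ℤˣ), g z * ∑ i, ((z.2 i : ℤ) : 𝕜) * c₂ i z.1 := by
    simp only [Finset.mul_expect]
    rw [← Finset.expect_sum_comm, ← Finset.expect_add_distrib]
    refine Finset.expect_congr rfl fun z _ => ?_
    rw [← mul_add, ← Finset.sum_add_distrib, Finset.mul_sum]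
    refine Finset.sum_congr rfl fun i _ => ?_
    rw [← mul_add, ← hc]
    ring
  have hnv : ∀ i ω, ‖(v i ω : 𝕜)‖ = v i ω := fun i ω => by
    rw [RCLike.norm_ofReal, abs_of_nonneg (hv i ω)]
  have hle : ∀ i, 0 < ‖a i‖ → ∀ ω, (‖a i‖ * v i ω ≤ 1 ↔ v i ω ≤ ‖a i‖⁻¹) := fun i hi ω => by
    rw [← one_div, le_div_iff₀ hi, mul_comm]
  have h₁ : ∑ i, 𝔼 ω, ‖c₁ i ω‖ ^ 2 ≤ A := by
    have : ∀ i, 𝔼 ω, ‖c₁ i ω‖ ^ 2 ≤ A * ‖a i‖ ^ α := by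
      intro i
      rcases (norm_nonneg (a i)).eq_or_lt with h | h
      · have h' : a i = 0 := norm_eq_zero.mp h.symm
        simpa [c₁, h'] using by positivity
      · have := mul_le_mul_of_nonneg_left (hsmall i _ (inv_pos.mpr h)) (sq_nonneg ‖a i‖)
        rw [Finset.mul_expect] at this
        refine le_trans (le_of_eq (Finset.expect_congr rfl fun ω _ => ?_))
          (this.trans (le_of_eq ?_))
        · simp only [c₁, hle i h]
          split_ifs <;> simp [hnv, mul_pow]
        · rw [Real.inv_rpow h.le, ← Real.rpow_neg h.le, ← Real.rpow_natCast, mul_left_comm,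
            ← Real.rpow_add h]
          congr 2; push_cast; ring
    calc _ ≤ ∑ i, A * ‖a i‖ ^ α := Finset.sum_le_sum fun i _ => this i
      _ ≤ A := by rw [← Finset.mul_sum]; exact mul_le_of_le_one_right hA ha
  have h₂ : ∑ i, 𝔼 ω, ‖c₂ i ω‖ ^ β ≤ A := by
    have hβ0 : β ≠ 0 := hβr.ne_zero
    have : ∀ i, 𝔼 ω, ‖c₂ i ω‖ ^ β ≤ A * ‖a i‖ ^ α := by
      intro i
      rcases (norm_nonneg (a i)).eq_or_lt with h | h
      · have h' : a i = 0 := norm_eq_zero.mp h.symm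
        simpa [c₂, h', Real.zero_rpow hβ0] using by positivity
      · have := mul_le_mul_of_nonneg_left (hlarge i _ (inv_pos.mpr h))
          (Real.rpow_nonneg h.le β)
        rw [Finset.mul_expect] at this
        refine le_trans (le_of_eq (Finset.expect_congr rfl fun ω _ => ?_))
          (this.trans (le_of_eq ?_))
        · simp only [c₂, hle i h]
          split_ifs <;> simp [hnv, Real.mul_rpow, hv, Real.zero_rpow hβ0]
        · rw [Real.inv_rpow h.le, ← Real.rpow_neg h.le, mul_left_comm, ← Real.rpow_add h]
          congr 2; ring
    calc _ ≤ ∑ i, A * ‖a i‖ ^ α := Finset.sum_le_sum fun i _ => this i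
      _ ≤ A := by rw [← Finset.mul_sum]; exact mul_le_of_le_one_right hA ha
  rw [hsplit, add_mul]
  refine (norm_add_le _ _).trans (add_le_add ?_ ?_)
  · exact (norm_expect_mul_le hβr g _).trans (mul_le_mul_of_nonneg_right
      (Lp_sign_sum_le_of_sq hβr.pos hβ2 h₁)
      (Real.rpow_nonneg (expect_nonneg_of fun _ => by positivity) _))
  · exact (norm_expect_mul_le hβr g _).trans (mul_le_mul_of_nonneg_right
      (Lp_sign_sum_le_of_rpow hβr.pos hβ2 h₂)
      (Real.rpow_nonneg (expect_nonneg_of fun _ => by positivity) _))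

/-- The coefficients of a function of `L^r` along signed functions with the truncated moments of an
`α`-stable variable lie in `ℓ_q`. -/
lemma Lq_sign_coeff_le {α q β r A : ℝ} (hαq : α.HolderConjugate q)
    (hβr : β.HolderConjugate r) (hβ2 : β ≤ 2) (hA : 0 ≤ A) {v : ι → Ω → ℝ}
    (hv : ∀ i ω, 0 ≤ v i ω)
    (hsmall : ∀ i t, 0 < t → 𝔼 ω, (if v i ω ≤ t then v i ω ^ 2 else 0) ≤ A * t ^ (2 - α))
    (hlarge : ∀ i t, 0 < t → 𝔼 ω, (if v i ω ≤ t then 0 else v i ω ^ β) ≤ A * t ^ (β - α))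
    (g : Ω × (ι → ℤˣ) → 𝕜) :
    (∑ i, ‖𝔼 z : Ω × (ι → ℤˣ), g z * (((z.2 i : ℤ) : 𝕜) * (v i z.1 : 𝕜))‖ ^ q) ^ (1 / q) ≤
      (A ^ (1 / 2 : ℝ) + A ^ (1 / β)) * (𝔼 z, ‖g z‖ ^ r) ^ (1 / r) :=
  Lq_le_of_forall_pairing_le hαq fun _ ha =>
    sign_coeff_pairing_le hβr hβ2 hA hv hsmall hlarge g ha

end Signs

/-! ### Discretised stable weights -/

lemma rpow_neg_le_sub_of_lt_one {s : ℝ} (hs0 : 0 ≤ s) (hs : s < 1) (n : ℕ) :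
    ((n : ℝ) + 1) ^ (-s) ≤ (((n : ℝ) + 1) ^ (1 - s) - (n : ℝ) ^ (1 - s)) / (1 - s) := by
  have hn : (0 : ℝ) < (n : ℝ) + 1 := by positivity
  have h := rpow_one_add_le_one_add_mul_self (s := -1 / ((n : ℝ) + 1)) (p := 1 - s)
    (by rw [le_div_iff₀ hn]; linarith [(Nat.cast_nonneg n : (0 : ℝ) ≤ n)]) (by linarith)
    (by linarith)
  have e : 1 + -1 / ((n : ℝ) + 1) = n / (n + 1) := by field_simp; ring
  rw [e, Real.div_rpow (Nat.cast_nonneg n) hn.le, div_le_iff₀ (by positivity)] at h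
  rw [le_div_iff₀ (by linarith)]
  have e2 : ((n : ℝ) + 1) ^ (1 - s) = (n + 1) * ((n : ℝ) + 1) ^ (-s) := by
    rw [sub_eq_add_neg, Real.rpow_add hn, Real.rpow_one]
  rw [e2] at h ⊢
  have e3 : (1 + (1 - s) * (-1 / ((n : ℝ) + 1))) * ((n + 1) * ((n : ℝ) + 1) ^ (-s)) =
      (n + 1) * ((n : ℝ) + 1) ^ (-s) - (1 - s) * ((n : ℝ) + 1) ^ (-s) := by field_simp; ring
  linarith

lemma rpow_neg_le_sub_of_one_lt {s : ℝ} (hs : 1 < s) (n : ℕ) :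
    ((n : ℝ) + 1) ^ (-s) ≤
      2 ^ s / (s - 1) * (((n : ℝ) + 1) ^ (1 - s) - ((n : ℝ) + 2) ^ (1 - s)) := by
  have hn : (0 : ℝ) < (n : ℝ) + 1 := by positivity
  have h := one_add_mul_self_le_rpow_one_add (s := 1 / ((n : ℝ) + 1)) (p := s)
    (by have : 0 < 1 / ((n : ℝ) + 1) := by positivity
        linarith) hs.le
  have e : 1 + 1 / ((n : ℝ) + 1) = (n + 2) / (n + 1) := by field_simp; ring
  have hm : (0 : ℝ) < (n : ℝ) + 2 := by positivity
  rw [e, Real.div_rpow hm.le hn.le, le_div_iff₀ (by positivity)] at h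
  have ha : ((n : ℝ) + 1) ^ (1 - s) = (n + 1) * ((n : ℝ) + 1) ^ (-s) := by
    rw [sub_eq_add_neg, Real.rpow_add hn, Real.rpow_one]
  have hb : ((n : ℝ) + 2) ^ (1 - s) = (n + 2) * ((n : ℝ) + 2) ^ (-s) := by
    rw [sub_eq_add_neg, Real.rpow_add hm, Real.rpow_one]
  have ia : ((n : ℝ) + 1) ^ s * ((n : ℝ) + 1) ^ (-s) = 1 := by rw [← Real.rpow_add hn]; simp
  have ib : ((n : ℝ) + 2) ^ s * ((n : ℝ) + 2) ^ (-s) = 1 := by rw [← Real.rpow_add hm]; simp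
  have pa : 0 < ((n : ℝ) + 1) ^ (-s) := by positivity
  have pb : 0 < ((n : ℝ) + 2) ^ (-s) := by positivity
  have h1 : (s - 1) * ((n : ℝ) + 2) ^ (-s) ≤
      ((n : ℝ) + 1) ^ (1 - s) - ((n : ℝ) + 2) ^ (1 - s) := by
    have h2 := mul_le_mul_of_nonneg_right h (mul_pos (mul_pos hn pa) pb).le
    have e1 : (1 + s * (1 / ((n : ℝ) + 1))) * ((n : ℝ) + 1) ^ s *
        ((n + 1) * ((n : ℝ) + 1) ^ (-s) * ((n : ℝ) + 2) ^ (-s)) =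
        (n + 1 + s) * ((n : ℝ) + 2) ^ (-s) := by
      have : (1 + s * (1 / ((n : ℝ) + 1))) * (n + 1) = n + 1 + s := by field_simp
      linear_combination (1 + s * (1 / ((n : ℝ) + 1))) * (n + 1) * ((n : ℝ) + 2) ^ (-s) * ia +
        ((n : ℝ) + 2) ^ (-s) * this
    have e2 : ((n : ℝ) + 2) ^ s * ((n + 1) * ((n : ℝ) + 1) ^ (-s) * ((n : ℝ) + 2) ^ (-s)) =
        (n + 1) * ((n : ℝ) + 1) ^ (-s) := by
      linear_combination ((n : ℝ) + 1) * ((n : ℝ) + 1) ^ (-s) * ib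
    rw [e1, e2] at h2
    rw [ha, hb]
    linarith
  have h3 : ((n : ℝ) + 1) ^ (-s) ≤ 2 ^ s * ((n : ℝ) + 2) ^ (-s) := by
    have : ((n : ℝ) + 2) ^ s ≤ 2 ^ s * ((n : ℝ) + 1) ^ s := by
      rw [← Real.mul_rpow zero_le_two hn.le]
      exact Real.rpow_le_rpow hm.le (by linarith [(Nat.cast_nonneg n : (0 : ℝ) ≤ n)]) (by linarith)
    have := mul_le_mul_of_nonneg_right this (mul_pos pa pb).le
    linear_combination this - ((n : ℝ) + 1) ^ (-s) * ib + 2 ^ s * ((n : ℝ) + 2) ^ (-s) * ia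
  have h4 : (0 : ℝ) < s - 1 := by linarith
  calc ((n : ℝ) + 1) ^ (-s) ≤ 2 ^ s * ((n : ℝ) + 2) ^ (-s) := h3
    _ = 2 ^ s / (s - 1) * ((s - 1) * ((n : ℝ) + 2) ^ (-s)) := by field_simp
    _ ≤ _ := mul_le_mul_of_nonneg_left h1 (by positivity)

lemma sum_rpow_neg_lt_le {s : ℝ} (hs0 : 0 ≤ s) (hs : s < 1) (M : ℕ) {x : ℝ} (hx : 0 ≤ x) :
    ∑ m ∈ Finset.range M, (if (m : ℝ) + 1 < x then ((m : ℝ) + 1) ^ (-s) else 0) ≤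
      x ^ (1 - s) / (1 - s) := by
  have h1 : (0 : ℝ) < 1 - s := by linarith
  have key : ∑ m ∈ Finset.range M, (if (m : ℝ) + 1 < x then ((m : ℝ) + 1) ^ (-s) else 0) ≤
      (min (M : ℝ) x) ^ (1 - s) / (1 - s) := by
    induction M with
    | zero => simp only [Finset.range_zero, Finset.sum_empty, Nat.cast_zero]; positivity
    | succ M ih =>
      rw [Finset.sum_range_succ]
      have hmono : (min (M : ℝ) x) ^ (1 - s) ≤ (min ((M + 1 : ℕ) : ℝ) x) ^ (1 - s) :=
        Real.rpow_le_rpow (by positivity) (min_le_min_right _ (by push_cast; linarith)) h1.le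
      split_ifs with h
      · have e1 : min (M : ℝ) x = M := min_eq_left (by linarith)
        have e2 : min ((M + 1 : ℕ) : ℝ) x = M + 1 := by push_cast; exact min_eq_left h.le
        rw [e2]
        rw [e1] at ih
        have := rpow_neg_le_sub_of_lt_one hs0 hs M
        rw [sub_div] at this
        linarith
      · rw [add_zero]
        exact ih.trans (by gcongr)
  exact key.trans (by gcongr; exact min_le_right _ _)

lemma sum_rpow_neg_ge_le {s : ℝ} (hs : 1 < s) (M : ℕ) {x : ℝ} (hx : 0 < x) :
    ∑ m ∈ Finset.range M, (if x ≤ (m : ℝ) + 1 then ((m : ℝ) + 1) ^ (-s) else 0) ≤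
      2 ^ s / (s - 1) * x ^ (1 - s) := by
  have h1 : (0 : ℝ) < s - 1 := by linarith
  have key : ∑ m ∈ Finset.range M, (if x ≤ (m : ℝ) + 1 then ((m : ℝ) + 1) ^ (-s) else 0) ≤
      2 ^ s / (s - 1) * (x ^ (1 - s) - (max x ((M : ℝ) + 1)) ^ (1 - s)) := by
    induction M with
    | zero =>
      simp only [Finset.range_zero, Finset.sum_empty]
      have : (max x (((0 : ℕ) : ℝ) + 1)) ^ (1 - s) ≤ x ^ (1 - s) :=
        Real.rpow_le_rpow_of_nonpos hx (le_max_left _ _) (by linarith)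
      exact mul_nonneg (by positivity) (by linarith)
    | succ M ih =>
      rw [Finset.sum_range_succ]
      split_ifs with h
      · have e1 : max x ((M : ℝ) + 1) = M + 1 := max_eq_right h
        have e2 : max x (((M + 1 : ℕ) : ℝ) + 1) = M + 2 := by
          push_cast; rw [max_eq_right (by linarith)]; ring
        rw [e2]
        rw [e1] at ih
        have := rpow_neg_le_sub_of_one_lt hs M
        linarith
      · rw [add_zero]
        refine ih.trans (mul_le_mul_of_nonneg_left ?_ (by positivity))
        have : (max x (((M + 1 : ℕ) : ℝ) + 1)) ^ (1 - s) ≤ (max x ((M : ℝ) + 1)) ^ (1 - s) :=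
          Real.rpow_le_rpow_of_nonpos (by positivity)
            (max_le_max_left _ (by push_cast; linarith)) (by linarith)
        linarith
  refine key.trans (mul_le_mul_of_nonneg_left ?_ (by positivity))
  have : 0 ≤ (max x ((M : ℝ) + 1)) ^ (1 - s) := by positivity
  linarith

/-- The magnitudes of a discretised, truncated `α`-stable variable: `m` being uniform on
`{0, …, M - 1}`, the weight exceeds `t` with probability about `t ^ (-α)`. -/
noncomputable def stableWeight (α : ℝ) (M : ℕ) (m : Fin M) : ℝ :=
  ((M : ℝ) / ((m : ℕ) + 1)) ^ (1 / α)

lemma stableWeight_nonneg (α : ℝ) (M : ℕ) (m : Fin M) : 0 ≤ stableWeight α M m := by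
  unfold stableWeight; positivity

lemma stableWeight_le_iff {α : ℝ} (hα : 0 < α) (M : ℕ) (m : Fin M) {t : ℝ} (ht : 0 < t) :
    stableWeight α M m ≤ t ↔ M * t ^ (-α) ≤ ((m : ℕ) : ℝ) + 1 := by
  rw [stableWeight, one_div, Real.rpow_inv_le_iff_of_pos (by positivity) ht.le hα,
    div_le_iff₀ (by positivity), Real.rpow_neg ht.le, ← div_eq_mul_inv,
    div_le_iff₀ (by positivity), mul_comm]

lemma stableWeight_rpow {α : ℝ} (M : ℕ) (m : Fin M) (γ : ℝ) :
    stableWeight α M m ^ γ = (M : ℝ) ^ (γ / α) * (((m : ℕ) : ℝ) + 1) ^ (-(γ / α)) := by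
  rw [stableWeight, ← Real.rpow_mul (by positivity), Real.div_rpow (by positivity) (by positivity),
    Real.rpow_neg (by positivity), div_eq_mul_inv, one_div_mul_eq_div]

lemma expect_stableWeight_small {α : ℝ} (hα : 0 < α) (hα2 : α < 2) {M : ℕ} (hM : 0 < M) {t : ℝ}
    (ht : 0 < t) :
    𝔼 m, (if stableWeight α M m ≤ t then stableWeight α M m ^ 2 else 0) ≤
      2 ^ (2 / α) / (2 / α - 1) * t ^ (2 - α) := by
  have hM' : (0 : ℝ) < M := by exact_mod_cast hM
  have hs : 1 < 2 / α := by rwa [lt_div_iff₀ hα, one_mul]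
  rw [Fintype.expect_eq_sum_div_card, Fintype.card_fin, div_le_iff₀ hM']
  have h := sum_rpow_neg_ge_le hs M (x := M * t ^ (-α)) (by positivity)
  have e : ∑ m, (if stableWeight α M m ≤ t then stableWeight α M m ^ 2 else 0) =
      (M : ℝ) ^ (2 / α) * ∑ m ∈ Finset.range M,
        (if (M : ℝ) * t ^ (-α) ≤ (m : ℝ) + 1 then ((m : ℝ) + 1) ^ (-(2 / α)) else 0) := by
    rw [Finset.sum_range, Finset.mul_sum]
    refine Finset.sum_congr rfl fun m _ => ?_
    simp only [stableWeight_le_iff hα M m ht, ← Real.rpow_two, stableWeight_rpow]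
    split_ifs <;> simp
  rw [e]
  refine (mul_le_mul_of_nonneg_left h (by positivity)).trans (le_of_eq ?_)
  rw [Real.mul_rpow hM'.le (by positivity), ← Real.rpow_mul ht.le]
  have e1 : -α * (1 - 2 / α) = 2 - α := by field_simp; ring
  have e2 : (M : ℝ) ^ (2 / α) * (M : ℝ) ^ (1 - 2 / α) = M := by
    rw [← Real.rpow_add hM']; simp
  rw [e1]
  linear_combination (2 ^ (2 / α) / (2 / α - 1) * t ^ (2 - α)) * e2

lemma expect_stableWeight_large {α β : ℝ} (hα : 0 < α) (hβ : 0 < β) (hβα : β < α) {M : ℕ}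
    (hM : 0 < M) {t : ℝ} (ht : 0 < t) :
    𝔼 m, (if stableWeight α M m ≤ t then 0 else stableWeight α M m ^ β) ≤
      1 / (1 - β / α) * t ^ (β - α) := by
  have hM' : (0 : ℝ) < M := by exact_mod_cast hM
  have hs : β / α < 1 := by rwa [div_lt_iff₀ hα, one_mul]
  rw [Fintype.expect_eq_sum_div_card, Fintype.card_fin, div_le_iff₀ hM']
  have h := sum_rpow_neg_lt_le (by positivity) hs M (x := M * t ^ (-α)) (by positivity)
  have e : ∑ m, (if stableWeight α M m ≤ t then 0 else stableWeight α M m ^ β) =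
      (M : ℝ) ^ (β / α) * ∑ m ∈ Finset.range M,
        (if (m : ℝ) + 1 < M * t ^ (-α) then ((m : ℝ) + 1) ^ (-(β / α)) else 0) := by
    rw [Finset.sum_range, Finset.mul_sum]
    refine Finset.sum_congr rfl fun m _ => ?_
    simp only [stableWeight_le_iff hα M m ht, stableWeight_rpow, ← not_le]
    split_ifs <;> simp
  rw [e]
  refine (mul_le_mul_of_nonneg_left h (by positivity)).trans (le_of_eq ?_)
  rw [Real.mul_rpow hM'.le (by positivity), ← Real.rpow_mul ht.le]
  have e1 : -α * (1 - β / α) = β - α := by field_simp; ring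
  have e2 : (M : ℝ) ^ (β / α) * (M : ℝ) ^ (1 - β / α) = M := by
    rw [← Real.rpow_add hM']; simp
  rw [e1]
  linear_combination (1 / (1 - β / α) * t ^ (β - α)) * e2

/-- A constant bounding the truncated moments of `stableWeight α` of orders `2` and `β`. -/
noncomputable def stableMoment (α β : ℝ) : ℝ :=
  max (2 ^ (2 / α) / (2 / α - 1)) (1 / (1 - β / α))

/-- The bound for the operator taking a function in `L^r` to its coefficients, in `ℓ_q`, along
signed stable weights; it does not depend on the number of weights nor on the discretisation. -/
noncomputable def stableConst (α β : ℝ) : ℝ :=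
  stableMoment α β ^ (1 / 2 : ℝ) + stableMoment α β ^ (1 / β)

lemma stableMoment_nonneg {α β : ℝ} (hα : 0 < α) (hα2 : α < 2) : 0 ≤ stableMoment α β := by
  have hs : 1 < 2 / α := by rwa [lt_div_iff₀ hα, one_mul]
  have : 0 < 2 / α - 1 := by linarith
  exact le_max_of_le_left (by positivity)

lemma stableConst_nonneg {α β : ℝ} (hα : 0 < α) (hα2 : α < 2) : 0 ≤ stableConst α β := by
  have := stableMoment_nonneg (β := β) hα hα2
  unfold stableConst
  positivity

/-- Signed stable weights satisfy the upper estimate of independent `α`-stable variables. Nothing is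
assumed on the joint distribution of the magnitudes `μ i`, each of which is uniform on `Fin M`. -/
lemma Lq_stable_coeff_le {𝕜 : Type*} [RCLike 𝕜] {ι Ω : Type*} [Fintype ι] [DecidableEq ι]
    [Fintype Ω] [Nonempty Ω] {α q β r : ℝ} (hαq : α.HolderConjugate q)
    (hβr : β.HolderConjugate r) (hβα : β < α) (hα2 : α < 2) {M : ℕ} (hM : 0 < M)
    {μ : ι → Ω → Fin M} (hμ : ∀ i (F : Fin M → ℝ), 𝔼 ω, F (μ i ω) = 𝔼 m, F m)
    (g : Ω × (ι → ℤˣ) → 𝕜) :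
    (∑ i, ‖𝔼 z : Ω × (ι → ℤˣ),
        g z * (((z.2 i : ℤ) : 𝕜) * (stableWeight α M (μ i z.1) : 𝕜))‖ ^ q) ^ (1 / q) ≤
      stableConst α β * (𝔼 z, ‖g z‖ ^ r) ^ (1 / r) := by
  refine Lq_sign_coeff_le hαq hβr (hβα.trans hα2).le (stableMoment_nonneg hαq.pos hα2)
    (v := fun i ω => stableWeight α M (μ i ω)) (fun i ω => stableWeight_nonneg _ _ _)
    (fun i t ht => ?_) (fun i t ht => ?_) g
  · rw [hμ i fun m => if stableWeight α M m ≤ t then stableWeight α M m ^ 2 else 0]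
    exact (expect_stableWeight_small hαq.pos hα2 hM ht).trans
      (mul_le_mul_of_nonneg_right (le_max_left _ _) (by positivity))
  · rw [hμ i fun m => if stableWeight α M m ≤ t then 0 else stableWeight α M m ^ β]
    exact (expect_stableWeight_large hαq.pos hβr.pos hβα hM ht).trans
      (mul_le_mul_of_nonneg_right (le_max_right _ _) (by positivity))

/-! ### Lifting vectors of `ℓ_q` to bounded functions -/

lemma expect_prod_pi {ι κ : Type*} [Fintype ι] [DecidableEq ι] [Fintype κ]
    (φ : ι → κ → ℝ) : 𝔼 ω : ι → κ, ∏ l, φ l (ω l) = ∏ l, 𝔼 m, φ l m := by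
  simp only [Fintype.expect_eq_sum_div_card, Finset.prod_div_distrib, Finset.prod_univ_sum,
    Fintype.piFinset_univ, Finset.prod_const, Fintype.card_fun, Finset.card_univ, Nat.cast_pow]

lemma expect_pi_apply {ι κ : Type*} [Fintype ι] [DecidableEq ι] [Fintype κ] [Nonempty κ]
    (i : ι) (F : κ → ℝ) : 𝔼 ω : ι → κ, F (ω i) = 𝔼 m, F m := by
  have h := expect_prod_pi (fun l => if l = i then F else fun _ : κ => (1 : ℝ))
  have e1 : ∀ ω : ι → κ, ∏ l, (if l = i then F else fun _ : κ => (1 : ℝ)) (ω l) = F (ω i) :=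
    fun ω => by rw [Finset.prod_eq_single i] <;> simp +contextual
  have e2 : ∏ l, 𝔼 m, (if l = i then F else fun _ : κ => (1 : ℝ)) m = 𝔼 m, F m := by
    rw [Finset.prod_eq_single i] <;> simp +contextual
  simpa only [e1, e2] using h

lemma expect_pi_mul_apply {ι κ : Type*} [Fintype ι] [DecidableEq ι] [Fintype κ] [Nonempty κ]
    {i j : ι} (hij : i ≠ j) (F G : κ → ℝ) :
    𝔼 ω : ι → κ, F (ω i) * G (ω j) = (𝔼 m, F m) * 𝔼 m, G m := by
  have h := expect_prod_pi (fun l => if l = i then F else if l = j then G else fun _ : κ => (1 : ℝ))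
  have e1 : ∀ ω : ι → κ, ∏ l, (if l = i then F else if l = j then G else fun _ : κ => (1 : ℝ)) (ω l)
      = F (ω i) * G (ω j) := fun ω => by
    rw [Finset.prod_eq_mul i j hij] <;> simp +contextual [hij.symm]
  have e2 : ∏ l, 𝔼 m, (if l = i then F else if l = j then G else fun _ : κ => (1 : ℝ)) m
      = (𝔼 m, F m) * 𝔼 m, G m := by
    rw [Finset.prod_eq_mul i j hij] <;> simp +contextual [hij.symm]
  simpa only [e1, e2] using h

/-- A lower bound for the part of the mean of the weight carried by its `τ` largest values. -/
lemma le_expect_stableWeight_lt {α q : ℝ} (hαq : α.HolderConjugate q) {M τ : ℕ} (hτ : τ ≤ M) :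
    ((τ : ℝ) / M) ^ (1 / q) ≤ 𝔼 m : Fin M, (if (m : ℕ) < τ then stableWeight α M m else 0) := by
  rcases Nat.eq_zero_or_pos τ with rfl | hτ0
  · simp [hαq.symm.ne_zero]
  have hτ0' : (0 : ℝ) < τ := by exact_mod_cast hτ0
  have hM' : (0 : ℝ) < M := by exact_mod_cast hτ0.trans_le hτ
  have hτM : (τ : ℝ) ≤ M := by exact_mod_cast hτ
  rw [Fintype.expect_eq_sum_div_card, Fintype.card_fin, le_div_iff₀ hM']
  have h1 : ∑ m : Fin M, (if (m : ℕ) < τ then ((M : ℝ) / τ) ^ (1 / α) else 0) ≤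
      ∑ m : Fin M, (if (m : ℕ) < τ then stableWeight α M m else 0) := by
    refine Finset.sum_le_sum fun m _ => ?_
    split_ifs with h
    · have : ((m : ℕ) : ℝ) + 1 ≤ τ := by exact_mod_cast h
      exact Real.rpow_le_rpow (by positivity) (by gcongr) (by simpa using hαq.nonneg)
    · exact le_rfl
  refine le_trans (le_of_eq ?_) h1
  have h2 : ∑ m : Fin M, (if (m : ℕ) < τ then ((M : ℝ) / τ) ^ (1 / α) else 0) =
      τ * ((M : ℝ) / τ) ^ (1 / α) := by
    rw [← Finset.sum_range (fun m => if m < τ then ((M : ℝ) / τ) ^ (1 / α) else 0),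
      ← Finset.sum_filter]
    have : (Finset.range M).filter (fun m => m < τ) = Finset.range τ := by
      ext m; simp; omega
    rw [this]; simp
  rw [h2]
  have h3 : 1 / q = 1 - 1 / α := by
    have := hαq.inv_add_inv_eq_one
    simp only [one_div]; linarith
  have h4 : (M : ℝ) / τ = ((τ : ℝ) / M)⁻¹ := by rw [inv_div]
  have h5 : (0 : ℝ) < τ / M := by positivity
  rw [h3, h4, Real.rpow_sub h5, Real.rpow_one, Real.inv_rpow h5.le]
  field_simp

section Lifting

variable {𝕜 : Type*} [RCLike 𝕜] {ι Ω : Type*} [Fintype ι] [DecidableEq ι] [Fintype Ω]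

/-- Vectors of the unit ball of `ℓ_q` are, up to the factor `8`, the coefficients of functions
bounded by `1`. The function is a signed sum of indicators of the events that exactly one weight,
the `i`-th one, is large; pairwise independence makes this event nearly as likely as the event that
the `i`-th weight is large. -/
lemma exists_bounded_with_stable_coeff {α q : ℝ} (hαq : α.HolderConjugate q) {M : ℕ} (hM : 0 < M)
    (hιM : 4 * Fintype.card ι ≤ M) {μ : ι → Ω → Fin M}
    (hμ : ∀ i (F : Fin M → ℝ), 𝔼 ω, F (μ i ω) = 𝔼 m, F m)
    (hind : ∀ i j, i ≠ j → ∀ F G : Fin M → ℝ,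
      𝔼 ω, F (μ i ω) * G (μ j ω) = (𝔼 m, F m) * 𝔼 m, G m)
    {y : ι → 𝕜} (hy : ∑ i, ‖y i‖ ^ q ≤ 1) :
    ∃ f : Ω × (ι → ℤˣ) → 𝕜, (∀ z, ‖f z‖ ≤ 1) ∧ ∀ i,
      𝔼 z : Ω × (ι → ℤˣ), f z * (((z.2 i : ℤ) : 𝕜) * (stableWeight α M (μ i z.1) : 𝕜)) =
        y i / 8 := by
  classical
  have hM' : (0 : ℝ) < M := by exact_mod_cast hM
  -- the `i`-th weight is large when its index is below `τ i`, an event of probability about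
  -- `‖y i‖ ^ q / 4`; the rounding up costs `1 / M ≤ 1 / (4 * card ι)`
  let τ : ι → ℕ := fun i => ⌈(M : ℝ) * (‖y i‖ ^ q / 4)⌉₊
  have hy1 : ∀ i, ‖y i‖ ^ q ≤ 1 := fun i =>
    (Finset.single_le_sum (f := fun i => ‖y i‖ ^ q) (fun _ _ => by positivity)
      (Finset.mem_univ i)).trans hy
  have hτM : ∀ i, τ i ≤ M := fun i => by
    refine Nat.ceil_le.mpr ?_
    have := hy1 i
    nlinarith
  have hτlow : ∀ i, ‖y i‖ ^ q / 4 ≤ (τ i : ℝ) / M := fun i => by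
    rw [le_div_iff₀ hM', mul_comm]; exact Nat.le_ceil _
  have hτup : ∀ i, (τ i : ℝ) / M ≤ ‖y i‖ ^ q / 4 + 1 / M := fun i => by
    rw [div_le_iff₀ hM', add_mul, one_div_mul_cancel hM'.ne', mul_comm (‖y i‖ ^ q / 4)]
    exact (Nat.ceil_lt_add_one (by positivity)).le
  let F : ι → Fin M → ℝ := fun i m => if (m : ℕ) < τ i then stableWeight α M m else 0
  let G : ι → Fin M → ℝ := fun i m => if (m : ℕ) < τ i then 1 else 0
  have hG : ∀ i, 𝔼 m, G i m = (τ i : ℝ) / M := fun i => by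
    rw [Fintype.expect_eq_sum_div_card, Fintype.card_fin]
    congr 1
    simp only [G]
    rw [← Finset.sum_range (fun m => if m < τ i then (1 : ℝ) else 0), ← Finset.sum_filter]
    have : (Finset.range M).filter (fun m => m < τ i) = Finset.range (τ i) := by
      ext m; have := hτM i; simp; omega
    rw [this]; simp
  have hGsum : ∑ i, (τ i : ℝ) / M ≤ 1 / 2 := by
    calc ∑ i, (τ i : ℝ) / M ≤ ∑ i, (‖y i‖ ^ q / 4 + 1 / M) := Finset.sum_le_sum fun i _ => hτup i
      _ = (∑ i, ‖y i‖ ^ q) / 4 + Fintype.card ι / M := by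
        rw [Finset.sum_add_distrib, ← Finset.sum_div]; simp [div_eq_mul_inv]
      _ ≤ 1 / 4 + 1 / 4 := by
        have : (Fintype.card ι : ℝ) / M ≤ 1 / 4 := by
          rw [div_le_iff₀ hM']
          have : (4 : ℝ) * Fintype.card ι ≤ M := by exact_mod_cast hιM
          linarith
        linarith
      _ = 1 / 2 := by norm_num
  -- `E i` is the event that the `i`-th weight is the only large one
  let E : ι → Ω → Prop := fun i ω =>
    ((μ i ω : ℕ) < τ i) ∧ ∀ j, j ≠ i → ¬ ((μ j ω : ℕ) < τ j)
  let D : ι → ℝ := fun i => 𝔼 ω, if E i ω then stableWeight α M (μ i ω) else 0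
  have hF0 : ∀ i m, 0 ≤ F i m := fun i m => by
    simp only [F]; split_ifs; exacts [stableWeight_nonneg _ _ _, le_rfl]
  have hpt : ∀ i ω, F i (μ i ω) - ∑ j ∈ Finset.univ.erase i, F i (μ i ω) * G j (μ j ω) ≤
      if E i ω then stableWeight α M (μ i ω) else 0 := by
    intro i ω
    have hG0 : ∀ j, 0 ≤ G j (μ j ω) := fun j => by simp only [G]; split_ifs <;> norm_num
    split_ifs with h
    · have : F i (μ i ω) = stableWeight α M (μ i ω) := by simp [F, h.1]
      rw [← this]
      exact sub_le_self _ (Finset.sum_nonneg fun j _ => mul_nonneg (hF0 _ _) (hG0 j))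
    · by_cases h1 : (μ i ω : ℕ) < τ i
      · obtain ⟨j, hji, hj⟩ : ∃ j, j ≠ i ∧ ((μ j ω : ℕ) < τ j) := by
          by_contra! hcon
          exact h ⟨h1, fun j hj => not_lt.mpr (hcon j hj)⟩
        have := Finset.single_le_sum (f := fun j => F i (μ i ω) * G j (μ j ω))
          (fun j _ => mul_nonneg (hF0 i _) (hG0 j))
          (Finset.mem_erase.mpr ⟨hji, Finset.mem_univ j⟩)
        have hGj : G j (μ j ω) = 1 := by simp [G, hj]
        simp only [hGj, mul_one] at this
        linarith
      · have : F i (μ i ω) = 0 := by simp [F, h1]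
        simp [this]
  have hD : ∀ i, ‖y i‖ / 8 ≤ D i := by
    intro i
    have hFi : 0 ≤ 𝔼 m, F i m := expect_nonneg_of (hF0 i)
    have h1 : (𝔼 m, F i m) - ∑ j ∈ Finset.univ.erase i, (𝔼 m, F i m) * ((τ j : ℝ) / M) ≤ D i := by
      have := Finset.expect_le_expect (s := Finset.univ) fun ω _ => hpt i ω
      refine le_trans (le_of_eq ?_) this
      rw [Finset.expect_sub_distrib, hμ i (F i), Finset.expect_sum_comm]
      congr 1
      refine Finset.sum_congr rfl fun j hj => ?_
      rw [hind i j (Finset.ne_of_mem_erase hj).symm, hG]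
    have h2 : ∑ j ∈ Finset.univ.erase i, (τ j : ℝ) / M ≤ 1 / 2 :=
      (Finset.sum_le_sum_of_subset_of_nonneg (Finset.erase_subset _ _)
        fun _ _ _ => by positivity).trans hGsum
    rw [← Finset.mul_sum] at h1
    have h3 : ‖y i‖ / 4 ≤ 𝔼 m, F i m := by
      refine le_trans ?_ (le_expect_stableWeight_lt hαq (hτM i))
      have hq : 0 < q := hαq.symm.pos
      calc ‖y i‖ / 4 ≤ ‖y i‖ / 4 ^ (1 / q) := by
            gcongr
            calc (4 : ℝ) ^ (1 / q) ≤ 4 ^ (1 : ℝ) :=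
                  Real.rpow_le_rpow_of_exponent_le (by norm_num)
                    (by rw [div_le_one hq]; exact hαq.symm.lt.le)
              _ = 4 := Real.rpow_one _
        _ = (‖y i‖ ^ q / 4) ^ (1 / q) := by
            rw [Real.div_rpow (by positivity) (by norm_num), ← Real.rpow_mul (norm_nonneg _),
              mul_one_div_cancel hq.ne', Real.rpow_one]
        _ ≤ _ := Real.rpow_le_rpow (by positivity) (hτlow i) (by positivity)
    nlinarith
  have hE : ∀ ω i j, E i ω → E j ω → i = j := fun ω i j hi hj => by
    by_contra hij
    exact hj.2 i hij hi.1
  -- the coefficients correct the exact values `D i`; where `D i = 0` also `y i = 0`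
  let γ : ι → 𝕜 := fun i => y i / 8 / (D i : 𝕜)
  have hDn : ∀ i, 0 ≤ D i := fun i => (by positivity : 0 ≤ ‖y i‖ / 8).trans (hD i)
  have hγ : ∀ i, ‖γ i‖ ≤ 1 := fun i => by
    simp only [γ, norm_div, RCLike.norm_ofReal, abs_of_nonneg (hDn i)]
    have : ‖(8 : 𝕜)‖ = 8 := by simp
    rw [this]
    exact div_le_one_of_le₀ (hD i) (hDn i)
  have hγD : ∀ i, γ i * (D i : 𝕜) = y i / 8 := fun i => by
    rcases (hDn i).eq_or_lt with h | h
    · have : y i = 0 := by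
        have := hD i
        rw [← h] at this
        exact norm_le_zero_iff.mp (by linarith)
      simp [γ, this]
    · have : (D i : 𝕜) ≠ 0 := by exact_mod_cast h.ne'
      simp only [γ]
      field_simp
  refine ⟨fun z => ∑ j, if E j z.1 then γ j * ((z.2 j : ℤ) : 𝕜) else 0, fun z => ?_, fun i => ?_⟩
  · beta_reduce
    by_cases h : ∃ i, E i z.1
    · obtain ⟨i, hi⟩ := h
      rw [Finset.sum_eq_single i (fun j _ hj => if_neg fun h' => hj (hE _ _ _ h' hi)) (by simp),
        if_pos hi, norm_mul, norm_signUnit, mul_one]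
      exact hγ i
    · push Not at h
      simp [h]
  · rw [← Finset.univ_product_univ, Finset.expect_product]
    have : ∀ ω : Ω, 𝔼 s : ι → ℤˣ, (∑ j, if E j ω then γ j * ((s j : ℤ) : 𝕜) else 0) *
        (((s i : ℤ) : 𝕜) * (stableWeight α M (μ i ω) : 𝕜)) =
        γ i * ((if E i ω then stableWeight α M (μ i ω) else 0 : ℝ) : 𝕜) := by
      intro ω
      have e : ∀ s : ι → ℤˣ, (∑ j, if E j ω then γ j * ((s j : ℤ) : 𝕜) else 0) *
          (((s i : ℤ) : 𝕜) * (stableWeight α M (μ i ω) : 𝕜)) =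
          ∑ j, (((s j : ℤ) : 𝕜) * ((s i : ℤ) : 𝕜)) *
            (if E j ω then γ j * (stableWeight α M (μ i ω) : 𝕜) else 0) := fun s => by
        rw [Finset.sum_mul]
        refine Finset.sum_congr rfl fun j _ => ?_
        split_ifs <;> ring
      simp only [e, Finset.expect_sum_comm, ← Finset.expect_mul, expect_sign_mul_sign]
      simp only [ite_mul, one_mul, zero_mul, Finset.sum_ite_eq', Finset.mem_univ, if_true]
      split_ifs <;> simp
    simp only [this]
    rw [← Finset.mul_expect, ← hγD, RCLike.ofReal_expect]

end Lifting

/-! ### Domination of operators from `ℓ_1` to `ℓ_q` -/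

section LiftEllOne

variable {𝕜 Y : Type*} [RCLike 𝕜] [NormedAddCommGroup Y] [NormedSpace 𝕜 Y] [CompleteSpace Y]

lemma Ell.summable_norm (x : Ell 𝕜 1) : Summable fun j => ‖x j‖ := by
  simpa using (lp.memℓp x).summable (by simp)

lemma Ell.norm_eq_tsum (x : Ell 𝕜 1) : ‖x‖ = ∑' j, ‖x j‖ := by
  simpa using lp.norm_eq_tsum_rpow (by simp) x

/-- The operator `ℓ_1 → Y` taking the unit vectors to a given sequence bounded by `C`. -/
noncomputable def ellOneLift (y : ℕ → Y) (C : ℝ) (hy : ∀ j, ‖y j‖ ≤ C) : Ell 𝕜 1 →L[𝕜] Y :=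
  have hle : ∀ x : Ell 𝕜 1, ∀ j, ‖x j • y j‖ ≤ ‖x j‖ * C := fun x j => by
    rw [norm_smul]; exact mul_le_mul_of_nonneg_left (hy j) (norm_nonneg _)
  have hs : ∀ x : Ell 𝕜 1, Summable fun j => x j • y j := fun x =>
    Summable.of_norm_bounded ((Ell.summable_norm x).mul_right C) (hle x)
  LinearMap.mkContinuous
    { toFun := fun x => ∑' j, x j • y j
      map_add' := fun a b => by
        rw [← (hs a).tsum_add (hs b)]
        simp only [lp.coeFn_add, Pi.add_apply, add_smul]
      map_smul' := fun c a => by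
        rw [RingHom.id_apply, ← (hs a).tsum_const_smul c]
        simp only [lp.coeFn_smul, Pi.smul_apply, smul_assoc] }
    C fun x => by
      rw [Ell.norm_eq_tsum, mul_comm, ← tsum_mul_right]
      exact tsum_of_norm_bounded ((Ell.summable_norm x).mul_right C).hasSum (hle x)

lemma ellOneLift_apply (y : ℕ → Y) (C : ℝ) (hy : ∀ j, ‖y j‖ ≤ C) (x : Ell 𝕜 1) :
    ellOneLift y C hy x = ∑' j, x j • y j := rfl

lemma ellOneLift_single (y : ℕ → Y) (C : ℝ) (hy : ∀ j, ‖y j‖ ≤ C) (j : ℕ) (a : 𝕜) :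
    ellOneLift y C hy (lp.single 1 j a) = a • y j := by
  rw [ellOneLift_apply, tsum_eq_single j]
  · simp
  · intro i hi
    simp [hi]

lemma norm_ellOneLift_le (y : ℕ → Y) (C : ℝ) (hC : 0 ≤ C) (hy : ∀ j, ‖y j‖ ≤ C) :
    ‖(ellOneLift y C hy : Ell 𝕜 1 →L[𝕜] Y)‖ ≤ C := by
  unfold ellOneLift
  exact LinearMap.mkContinuous_norm_le _ hC _

end LiftEllOne

/-- Operators `ℓ_1 → ℓ_q`, `q > 2`, satisfy for every `r > q` a Pietsch-type domination, with a
constant not depending on the number of coordinates taken into account. -/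
lemma exists_domination {𝕜 : Type*} [RCLike 𝕜] {p : ℝ≥0∞} [Fact (1 ≤ p)] {α β r : ℝ}
    (hαq : α.HolderConjugate p.toReal) (hβr : β.HolderConjugate r) (hβα : β < α) (hα2 : α < 2)
    (u : Ell 𝕜 1 →L[𝕜] Ell 𝕜 p) (N : ℕ) :
    ∃ (Z : Type) (_ : Fintype Z) (_ : Nonempty Z) (φ : Z → StrongDual 𝕜 (Ell 𝕜 1)),
      (∀ z, ‖φ z‖ ≤ 1) ∧ ∀ x, (∑ n : Fin N, ‖u x n‖ ^ p.toReal) ^ (1 / p.toReal) ≤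
        8 * (‖u‖ + 1) * stableConst α β * (𝔼 z, ‖φ z x‖ ^ r) ^ (1 / r) := by
  have hq : 0 < p.toReal := hαq.symm.pos
  let M : ℕ := 4 * N + 1
  have hM : 0 < M := Nat.succ_pos _
  -- adding `1` keeps the normalisation meaningful for `u = 0`
  let C : ℝ := ‖u‖ + 1
  have hC : 0 < C := by positivity
  have : Nonempty (Fin M) := ⟨⟨0, hM⟩⟩
  let μ : Fin N → (Fin N → Fin M) → Fin M := fun i ω => ω i
  have hμ : ∀ i (F : Fin M → ℝ), 𝔼 ω, F (μ i ω) = 𝔼 m, F m := fun i F => expect_pi_apply i F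
  let e : ℕ → Ell 𝕜 1 := fun j => lp.single 1 j (1 : 𝕜)
  have hy : ∀ j, ∑ n : Fin N, ‖(u (e j) n) / (C : 𝕜)‖ ^ p.toReal ≤ 1 := fun j => by
    have h1 : ∑ n : Fin N, ‖u (e j) n‖ ^ p.toReal ≤ ‖u (e j)‖ ^ p.toReal := by
      rw [← Finset.sum_range (fun n => ‖u (e j) n‖ ^ p.toReal)]
      exact lp.sum_rpow_le_norm_rpow hq _ _
    have h2 : ‖u (e j)‖ ≤ C := by
      refine (u.le_opNorm _).trans ?_
      have : ‖e j‖ = 1 := by simp [e, lp.norm_single]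
      rw [this]; simp [C]
    simp only [norm_div, RCLike.norm_ofReal, abs_of_pos hC, Real.div_rpow (norm_nonneg _) hC.le]
    rw [← Finset.sum_div, div_le_one (by positivity)]
    exact h1.trans (Real.rpow_le_rpow (norm_nonneg _) h2 hq.le)
  choose f hf1 hf using fun j => exists_bounded_with_stable_coeff hαq hM (ι := Fin N)
    (by simp [M]) hμ (fun i j hij F G => expect_pi_mul_apply hij F G) (hy j)
  let φ : (Fin N → Fin M) × (Fin N → ℤˣ) → StrongDual 𝕜 (Ell 𝕜 1) := fun z =>
    ellOneLift (fun j => f j z) 1 (fun j => hf1 j z)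
  refine ⟨(Fin N → Fin M) × (Fin N → ℤˣ), inferInstance, inferInstance, φ,
    fun z => norm_ellOneLift_le _ _ zero_le_one _, fun x => ?_⟩
  -- the coordinates of `u x` are the coefficients of `z ↦ φ z x`; it suffices to check unit vectors
  have hcoord : ∀ n : Fin N, 𝔼 z, φ z x *
      (((z.2 n : ℤ) : 𝕜) * (stableWeight α M (μ n z.1) : 𝕜)) = u x n / (8 * C : 𝕜) := by
    intro n
    let θ : (Fin N → Fin M) × (Fin N → ℤˣ) → 𝕜 := fun z =>
      ((z.2 n : ℤ) : 𝕜) * (stableWeight α M (μ n z.1) : 𝕜)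
    let A : StrongDual 𝕜 (Ell 𝕜 1) :=
      (Fintype.card ((Fin N → Fin M) × (Fin N → ℤˣ)) : 𝕜)⁻¹ • ∑ z, θ z • φ z
    let B : StrongDual 𝕜 (Ell 𝕜 1) :=
      (8 * C : 𝕜)⁻¹ • (lp.evalCLM 𝕜 (fun _ : ℕ => 𝕜) p (n : ℕ) ∘L u)
    have hA : ∀ x, A x = 𝔼 z, φ z x * θ z := fun x => by
      simp only [A, _root_.smul_apply, _root_.sum_apply, smul_eq_mul,
        Fintype.expect_eq_sum_div_card, div_eq_inv_mul]
      simp only [mul_comm]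
    have hB : ∀ x, B x = u x n / (8 * C : 𝕜) := fun x => by
      simp [B, div_eq_inv_mul, lp.evalCLM]
    have hAB : A = B := by
      refine lp.ext_continuousLinearMap (𝕜 := 𝕜) ENNReal.one_ne_top fun j => ?_
      ext
      simp only [ContinuousLinearMap.comp_apply, lp.singleContinuousLinearMap_apply]
      have h1 := hf j n
      have h2 : ∀ z, φ z (lp.single 1 j 1) = f j z := fun z => by
        simp only [φ, ellOneLift_single, one_smul]
      rw [hA, hB]
      simp only [h2]
      rw [h1, div_div, mul_comm (C : 𝕜)]
    rw [← hB, ← hAB, hA]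
  have h := Lq_stable_coeff_le hαq hβr hβα hα2 hM hμ (fun z => φ z x)
  simp only [hcoord, norm_div] at h
  have hn : ‖(8 * C : 𝕜)‖ = 8 * C := by
    rw [norm_mul, RCLike.norm_ofReal, abs_of_pos hC]; simp
  have h8 : 0 < 8 * C := by positivity
  simp only [hn, Real.div_rpow (norm_nonneg _) h8.le] at h
  rw [← Finset.sum_div, Real.div_rpow (Finset.sum_nonneg fun _ _ => by positivity) (by positivity),
    ← Real.rpow_mul h8.le, mul_one_div_cancel hq.ne', Real.rpow_one, div_le_iff₀ h8] at h
  refine h.trans (le_of_eq ?_)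
  ring

/-! ### Absolute summability of operators from `ℓ_1` to `ℓ_q`; Khintchine's inequality -/

/-- The form of `exists_domination` in which the functionals are replaced by the whole dual ball
and all coordinates are taken into account. -/
lemma sum_rpow_norm_le_of_forall_dual {𝕜 : Type*} [RCLike 𝕜] {p : ℝ≥0∞} [Fact (1 ≤ p)] {α β r : ℝ}
    (hαq : α.HolderConjugate p.toReal) (hβr : β.HolderConjugate r) (hβα : β < α) (hα2 : α < 2)
    (u : Ell 𝕜 1 →L[𝕜] Ell 𝕜 p) {κ : Type*} (s : Finset κ) (x : κ → Ell 𝕜 1) {V : ℝ}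
    (hV : ∀ φ : StrongDual 𝕜 (Ell 𝕜 1), ‖φ‖ ≤ 1 → ∑ i ∈ s, ‖φ (x i)‖ ^ r ≤ V) :
    ∑ i ∈ s, ‖u (x i)‖ ^ r ≤ (8 * (‖u‖ + 1) * stableConst α β) ^ r * V := by
  have hr : 0 < r := hβr.symm.pos
  have hq : 0 < p.toReal := hαq.symm.pos
  set K : ℝ := 8 * (‖u‖ + 1) * stableConst α β
  have hK : 0 ≤ K := mul_nonneg (by positivity) (stableConst_nonneg hαq.pos hα2)
  have hlim : ∀ y : Ell 𝕜 p, Tendsto (fun N : ℕ => (∑ n : Fin N, ‖y n‖ ^ p.toReal) ^ (1 / p.toReal))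
      atTop (𝓝 ‖y‖) := fun y => by
    rw [lp.norm_eq_tsum_rpow hq]
    simp only [← Finset.sum_range (fun n => ‖y n‖ ^ p.toReal)]
    exact ((lp.memℓp y).summable hq).hasSum.tendsto_sum_nat.rpow_const (Or.inr (by positivity))
  refine le_of_tendsto (tendsto_finsetSum s fun i _ =>
    (hlim (u (x i))).rpow_const (Or.inr hr.le)) (Eventually.of_forall fun N => ?_)
  obtain ⟨Z, _, _, φ, hφ, hdom⟩ := exists_domination hαq hβr hβα hα2 u N
  calc ∑ i ∈ s, ((∑ n : Fin N, ‖u (x i) n‖ ^ p.toReal) ^ (1 / p.toReal)) ^ r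
      ≤ ∑ i ∈ s, K ^ r * 𝔼 z, ‖φ z (x i)‖ ^ r := by
        refine Finset.sum_le_sum fun i _ => ?_
        have h0 : 0 ≤ 𝔼 z, ‖φ z (x i)‖ ^ r := expect_nonneg_of fun _ => by positivity
        have := Real.rpow_le_rpow (by positivity) (hdom (x i)) hr.le
        rwa [Real.mul_rpow hK (by positivity), ← Real.rpow_mul h0, one_div_mul_cancel hr.ne',
          Real.rpow_one] at this
    _ = K ^ r * 𝔼 z, ∑ i ∈ s, ‖φ z (x i)‖ ^ r := by
        rw [← Finset.mul_sum, Finset.expect_sum_comm]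
    _ ≤ K ^ r * V := by
        refine mul_le_mul_of_nonneg_left ?_ (by positivity)
        exact (Finset.expect_le_expect fun z _ => hV (φ z) (hφ z)).trans_eq (Fintype.expect_const V)

lemma enorm_rpow_eq_ofReal {E : Type*} [SeminormedAddGroup E] {r : ℝ} (hr : 0 ≤ r) (v : E) :
    ‖v‖ₑ ^ r = ENNReal.ofReal (‖v‖ ^ r) := by
  rw [← ENNReal.ofReal_rpow_of_nonneg (norm_nonneg _) hr, ofReal_norm]

/-- Every operator `ℓ_1 → ℓ_q` with `q > 2` is absolutely `r`-summing for every `r > q`. -/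
lemma isPSumming_of_lt {𝕜 : Type*} [RCLike 𝕜] {p : ℝ≥0∞} [Fact (1 ≤ p)] {α β r : ℝ}
    (hαq : α.HolderConjugate p.toReal) (hβr : β.HolderConjugate r) (hβα : β < α) (hα2 : α < 2)
    (u : Ell 𝕜 1 →L[𝕜] Ell 𝕜 p) : IsPSumming r u := by
  intro x hx
  have hr : 0 < r := hβr.symm.pos
  set W := weakNorm 𝕜 r x
  rw [strongNorm]
  refine ENNReal.rpow_lt_top_of_nonneg (by positivity) (ne_top_of_le_ne_top
    (b := ENNReal.ofReal ((8 * (‖u‖ + 1) * stableConst α β) ^ r * W.toReal ^ r))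
    ENNReal.ofReal_ne_top ?_)
  rw [ENNReal.tsum_eq_iSup_sum]
  refine iSup_le fun s => ?_
  simp only [enorm_rpow_eq_ofReal hr.le]
  rw [← ENNReal.ofReal_sum_of_nonneg fun _ _ => by positivity]
  refine ENNReal.ofReal_le_ofReal (sum_rpow_norm_le_of_forall_dual hαq hβr hβα hα2 u s x
    fun φ hφ => ?_)
  have h := (ENNReal.sum_le_tsum s).trans (tsum_le_weakNorm_rpow (𝕜 := 𝕜) hr x hφ)
  simp only [enorm_rpow_eq_ofReal hr.le] at h
  rw [← ENNReal.ofReal_sum_of_nonneg fun _ _ => by positivity] at h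
  have h2 := ENNReal.toReal_mono (ENNReal.rpow_lt_top_of_nonneg hr.le hx.ne).ne h
  rwa [ENNReal.toReal_ofReal (Finset.sum_nonneg fun _ _ => by positivity),
    ← ENNReal.toReal_rpow] at h2

section Khintchine

variable {𝕜 : Type*} [RCLike 𝕜] {ι : Type*} [Fintype ι] [DecidableEq ι]

lemma expect_exp_sign_sum_le (b : ι → ℝ) :
    𝔼 s : ι → ℤˣ, Real.exp (∑ i, ((s i : ℤ) : ℝ) * b i) ≤ Real.exp ((∑ i, b i ^ 2) / 2) := by
  simp only [Real.exp_sum]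
  rw [expect_prod_pi fun i (e : ℤˣ) => Real.exp (((e : ℤ) : ℝ) * b i), Finset.sum_div, Real.exp_sum]
  refine Finset.prod_le_prod (fun i _ => expect_nonneg_of fun _ => by positivity) fun i _ => ?_
  refine le_trans (le_of_eq ?_) (Real.cosh_le_exp_half_sq (b i))
  rw [Fintype.expect_eq_sum_div_card, Real.cosh_eq]
  simp [UnitsInt.univ]

lemma abs_pow_le_factorial_mul_exp (n : ℕ) (x : ℝ) :
    |x| ^ n ≤ n.factorial * (Real.exp x + Real.exp (-x)) := by
  have h := Real.pow_div_factorial_le_exp |x| (abs_nonneg x) n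
  rw [div_le_iff₀ (by positivity), mul_comm] at h
  refine h.trans (mul_le_mul_of_nonneg_left ?_ (by positivity))
  rcases abs_cases x with ⟨h, _⟩ | ⟨h, _⟩ <;> rw [h] <;>
    linarith [Real.exp_pos x, Real.exp_pos (-x)]

lemma expect_abs_sign_sum_pow_le (n : ℕ) {b : ι → ℝ} (hb : ∑ i, b i ^ 2 ≤ 1) :
    𝔼 s : ι → ℤˣ, |∑ i, ((s i : ℤ) : ℝ) * b i| ^ n ≤ n.factorial * 4 := by
  have hexp : Real.exp (1 / 2) ≤ 2 := by
    have h1 : Real.exp (1 / 2) ^ 2 = Real.exp 1 := by rw [← Real.exp_nat_mul]; norm_num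
    have h2 := Real.exp_one_lt_d9
    nlinarith [Real.exp_pos (1 / 2)]
  have h1 := (expect_exp_sign_sum_le b).trans
    (Real.exp_le_exp.mpr (by linarith : (∑ i, b i ^ 2) / 2 ≤ 1 / 2))
  have h2 := (expect_exp_sign_sum_le fun i => -b i).trans
    (Real.exp_le_exp.mpr (by simpa using by linarith : (∑ i, (-b i) ^ 2) / 2 ≤ 1 / 2))
  calc _ ≤ 𝔼 s : ι → ℤˣ, (n.factorial : ℝ) * (Real.exp (∑ i, ((s i : ℤ) : ℝ) * b i) +
        Real.exp (∑ i, ((s i : ℤ) : ℝ) * -b i)) := by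
        refine Finset.expect_le_expect fun s _ => ?_
        simpa using abs_pow_le_factorial_mul_exp n (∑ i, ((s i : ℤ) : ℝ) * b i)
    _ ≤ _ := by
        rw [← Finset.mul_expect, Finset.expect_add_distrib]
        exact mul_le_mul_of_nonneg_left (by linarith) (by positivity)

/-- Khintchine's inequality (the upper estimate) for natural exponents. -/
lemma expect_norm_sign_sum_pow_le (n : ℕ) (b : ι → 𝕜) :
    𝔼 s : ι → ℤˣ, ‖∑ i, ((s i : ℤ) : 𝕜) * b i‖ ^ n ≤
      2 ^ n * (n.factorial * 8) * (Real.sqrt (∑ i, ‖b i‖ ^ 2)) ^ n := by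
  have hone : ∀ b : ι → 𝕜, ∑ i, ‖b i‖ ^ 2 ≤ 1 →
      𝔼 s : ι → ℤˣ, ‖∑ i, ((s i : ℤ) : 𝕜) * b i‖ ^ n ≤ 2 ^ n * (n.factorial * 8) := by
    intro b hb
    have hre := expect_abs_sign_sum_pow_le n (b := fun i => RCLike.re (b i))
      ((Finset.sum_le_sum fun i _ => by
        rw [← sq_abs]; gcongr; exact RCLike.abs_re_le_norm _).trans hb)
    have him := expect_abs_sign_sum_pow_le n (b := fun i => RCLike.im (b i))
      ((Finset.sum_le_sum fun i _ => by
        rw [← sq_abs]; gcongr; exact RCLike.abs_im_le_norm _).trans hb)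
    calc _ ≤ 𝔼 s : ι → ℤˣ, (2 : ℝ) ^ n * (|∑ i, ((s i : ℤ) : ℝ) * RCLike.re (b i)| ^ n +
          |∑ i, ((s i : ℤ) : ℝ) * RCLike.im (b i)| ^ n) := by
          refine Finset.expect_le_expect fun s _ => ?_
          have e : ∀ i, ((s i : ℤ) : 𝕜) * b i = (((s i : ℤ) : ℝ) : 𝕜) * b i := fun i => by simp
          have e1 : ∑ i, ((s i : ℤ) : ℝ) * RCLike.re (b i) =
              RCLike.re (∑ i, ((s i : ℤ) : 𝕜) * b i) := by
            rw [map_sum]; simp only [e, RCLike.re_ofReal_mul]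
          have e2 : ∑ i, ((s i : ℤ) : ℝ) * RCLike.im (b i) =
              RCLike.im (∑ i, ((s i : ℤ) : 𝕜) * b i) := by
            rw [map_sum]; simp only [e, RCLike.im_ofReal_mul]
          rw [e1, e2]
          set z := ∑ i, ((s i : ℤ) : 𝕜) * b i
          have hz : ‖z‖ ≤ 2 * max |RCLike.re z| |RCLike.im z| := by
            have : ‖z‖ ≤ |RCLike.re z| + |RCLike.im z| := by
              have h := RCLike.norm_sq_eq_def (z := z)
              refine abs_le_of_sq_le_sq' ?_ (by positivity) |>.2
              nlinarith [abs_nonneg (RCLike.re z), abs_nonneg (RCLike.im z),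
                abs_mul_abs_self (RCLike.re z), abs_mul_abs_self (RCLike.im z)]
            linarith [le_max_left |RCLike.re z| |RCLike.im z|,
              le_max_right |RCLike.re z| |RCLike.im z|]
          refine (pow_le_pow_left₀ (norm_nonneg _) hz n).trans ?_
          rw [mul_pow]
          refine mul_le_mul_of_nonneg_left ?_ (by positivity)
          rcases max_cases |RCLike.re z| |RCLike.im z| with ⟨h, _⟩ | ⟨h, _⟩ <;> rw [h]
          · exact le_add_of_nonneg_right (by positivity)
          · exact le_add_of_nonneg_left (by positivity)
      _ ≤ _ := by
          rw [← Finset.mul_expect, Finset.expect_add_distrib]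
          exact mul_le_mul_of_nonneg_left (by linarith) (by positivity)
  have hV0 : 0 ≤ ∑ i, ‖b i‖ ^ 2 := Finset.sum_nonneg fun _ _ => by positivity
  rcases hV0.eq_or_lt with h | h
  · have hb : ∀ i, b i = 0 := fun i => by
      have := (Finset.sum_eq_zero_iff_of_nonneg fun i _ => sq_nonneg ‖b i‖).mp h.symm i
        (Finset.mem_univ i)
      simpa using this
    rcases Nat.eq_zero_or_pos n with rfl | hn
    · simp
    · simp [hb, hn.ne']
  · set σ := Real.sqrt (∑ i, ‖b i‖ ^ 2) with hσ
    have hσ0 : 0 < σ := Real.sqrt_pos.mpr h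
    have h1 := hone (fun i => (σ : 𝕜)⁻¹ * b i) (by
      simp only [norm_mul, norm_inv, RCLike.norm_ofReal, abs_of_pos hσ0, mul_pow, inv_pow]
      rw [← Finset.mul_sum, hσ, Real.sq_sqrt h.le, inv_mul_cancel₀ h.ne'])
    have e : ∀ s : ι → ℤˣ, ‖∑ i, ((s i : ℤ) : 𝕜) * ((σ : 𝕜)⁻¹ * b i)‖ ^ n =
        (σ ^ n)⁻¹ * ‖∑ i, ((s i : ℤ) : 𝕜) * b i‖ ^ n := fun s => by
      have : ∑ i, ((s i : ℤ) : 𝕜) * ((σ : 𝕜)⁻¹ * b i) =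
          (σ : 𝕜)⁻¹ * ∑ i, ((s i : ℤ) : 𝕜) * b i := by
        rw [Finset.mul_sum]; exact Finset.sum_congr rfl fun i _ => by ring
      rw [this, norm_mul, norm_inv, RCLike.norm_ofReal, abs_of_pos hσ0, mul_pow, inv_pow]
    simp only [e] at h1
    rw [← Finset.mul_expect, inv_mul_le_iff₀ (by positivity)] at h1
    linarith

end Khintchine

/-! ### Operators from `ℓ_1` to `ℓ_q` are almost summing -/

lemma radNorm_eq_ofReal {Y : Type*} [NormedAddCommGroup Y] {m : ℕ} (y : Fin m → Y) :
    radNorm y =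
      ENNReal.ofReal ((𝔼 s : Fin m → ℤˣ, ‖∑ i, (s i : ℤ) • y i‖ ^ 2) ^ (1 / 2 : ℝ)) := by
  rw [radNorm_eq_sum, ← ENNReal.ofReal_rpow_of_nonneg (expect_nonneg_of fun _ => by positivity)
    (by norm_num)]
  congr 1
  rw [Fintype.expect_eq_sum_div_card, div_eq_inv_mul, ENNReal.ofReal_mul (by positivity),
    ENNReal.ofReal_sum_of_nonneg fun _ _ => by positivity]
  congr 1
  · rw [ENNReal.ofReal_inv_of_pos (by positivity)]
    simp
  · refine Finset.sum_congr rfl fun s _ => ?_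
    rw [ENNReal.ofReal_pow (norm_nonneg _), ofReal_norm]

/-- Every operator `ℓ_1 → ℓ_q` with `q > 2` is almost summing. The exponent `r = n > q` is an
integer because Khintchine's inequality is only needed in that case. -/
lemma isAlmostSumming_of_lt {𝕜 : Type*} [RCLike 𝕜] {p : ℝ≥0∞} [Fact (1 ≤ p)] {α β : ℝ} {n : ℕ}
    (hn : 2 ≤ n)
    (hαq : α.HolderConjugate p.toReal) (hβr : β.HolderConjugate (n : ℝ)) (hβα : β < α) (hα2 : α < 2)
    (u : Ell 𝕜 1 →L[𝕜] Ell 𝕜 p) : IsAlmostSumming u := by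
  set K : ℝ := 8 * (‖u‖ + 1) * stableConst α β
  have hK : 0 ≤ K := mul_nonneg (by positivity) (stableConst_nonneg hαq.pos hα2)
  set B : ℝ := 2 ^ n * (n.factorial * 8)
  have hB : 0 ≤ B := by positivity
  have hn0 : (0 : ℝ) < n := by exact_mod_cast (by omega : 0 < n)
  refine ⟨Real.toNNReal (K * B ^ (1 / (n : ℝ))), fun m x => ?_⟩
  set W := weakNorm 𝕜 2 x with hWdef
  have hW : W ≠ ∞ := weakNorm_ne_top two_pos x
  -- the domination inequality is applied to the family of all signed sums of the given vectors
  let X : (Fin m → ℤˣ) → Ell 𝕜 1 := fun s => ∑ i, (s i : ℤ) • x i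
  have hV : ∀ φ : StrongDual 𝕜 (Ell 𝕜 1), ‖φ‖ ≤ 1 →
      ∑ s, ‖φ (X s)‖ ^ (n : ℝ) ≤ Fintype.card (Fin m → ℤˣ) * (B * W.toReal ^ n) := by
    intro φ hφ
    have h1 := expect_norm_sign_sum_pow_le n (fun i => φ (x i))
    have h2 : Real.sqrt (∑ i, ‖φ (x i)‖ ^ 2) ≤ W.toReal := by
      have h := tsum_le_weakNorm_rpow (𝕜 := 𝕜) two_pos x hφ
      simp only [tsum_fintype, enorm_rpow_eq_ofReal zero_le_two] at h
      rw [← ENNReal.ofReal_sum_of_nonneg fun _ _ => by positivity] at h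
      have h3 := ENNReal.toReal_mono (ENNReal.rpow_lt_top_of_nonneg zero_le_two hW).ne h
      rw [ENNReal.toReal_ofReal (Finset.sum_nonneg fun _ _ => by positivity),
        ← ENNReal.toReal_rpow] at h3
      simp only [Real.rpow_two] at h3
      exact Real.sqrt_le_iff.mpr ⟨ENNReal.toReal_nonneg, h3⟩
    have h3 : 𝔼 s : Fin m → ℤˣ, ‖∑ i, ((s i : ℤ) : 𝕜) * φ (x i)‖ ^ n ≤ B * W.toReal ^ n :=
      h1.trans (mul_le_mul_of_nonneg_left (pow_le_pow_left₀ (Real.sqrt_nonneg _) h2 n) hB)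
    rw [Fintype.expect_eq_sum_div_card, div_le_iff₀' (by positivity)] at h3
    refine le_trans (le_of_eq (Finset.sum_congr rfl fun s _ => ?_)) h3
    rw [Real.rpow_natCast]
    simp [X, zsmul_eq_mul]
  have h := sum_rpow_norm_le_of_forall_dual hαq hβr hβα hα2 u Finset.univ X hV
  have hE : 𝔼 s, ‖u (X s)‖ ^ (n : ℝ) ≤ K ^ (n : ℝ) * (B * W.toReal ^ n) := by
    rw [Fintype.expect_eq_sum_div_card, div_le_iff₀' (by positivity)]
    exact h.trans (le_of_eq (by ring))
  have hn2 : (1 : ℝ) ≤ n / 2 := by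
    have : (2 : ℝ) ≤ n := by exact_mod_cast hn
    linarith
  have h2 := expect_rpow_le hn2 (f := fun s => ‖u (X s)‖ ^ 2) fun s => by positivity
  have e : ∀ s, (‖u (X s)‖ ^ 2) ^ ((n : ℝ) / 2) = ‖u (X s)‖ ^ (n : ℝ) := fun s => by
    rw [← Real.rpow_two, ← Real.rpow_mul (norm_nonneg _)]; congr 1; ring
  simp only [e] at h2
  have h0 : 0 ≤ 𝔼 s, ‖u (X s)‖ ^ 2 := expect_nonneg_of fun s => by positivity
  have h3 : (𝔼 s, ‖u (X s)‖ ^ 2) ^ (1 / 2 : ℝ) ≤ K * B ^ (1 / (n : ℝ)) * W.toReal := by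
    have h4 := Real.rpow_le_rpow (by positivity) (h2.trans hE) (z := 1 / (n : ℝ)) (by positivity)
    rw [← Real.rpow_mul h0, Real.mul_rpow (by positivity) (by positivity),
      Real.mul_rpow hB (by positivity), ← Real.rpow_mul hK, mul_one_div_cancel hn0.ne',
      Real.rpow_one, ← Real.rpow_natCast, ← Real.rpow_mul ENNReal.toReal_nonneg,
      mul_one_div_cancel hn0.ne', Real.rpow_one, ← mul_assoc] at h4
    refine le_trans (le_of_eq ?_) h4
    congr 1
    field_simp
  rw [radNorm_eq_ofReal]
  have e2 : ∀ s : Fin m → ℤˣ, ∑ i, (s i : ℤ) • u (x i) = u (X s) := fun s => by simp [X]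
  simp only [e2]
  refine (ENNReal.ofReal_le_ofReal h3).trans (le_of_eq ?_)
  rw [ENNReal.ofReal_mul (by positivity), ENNReal.ofReal_toReal hW]
  rfl

/-! ### An operator from `ℓ_1` to `ℓ_q` that is not absolutely `q`-summing -/

section Harmonic

/-- The harmonic sum `1 + 1/2 + … + 1/N`, as a sum over `Fin N`. -/
noncomputable def harmonicSum (N : ℕ) : ℝ := ∑ m : Fin N, 1 / (((m : ℕ) : ℝ) + 1)

lemma harmonicSum_pos (n : ℕ) : 0 < harmonicSum (n + 1) :=
  Finset.sum_pos (fun _ _ => by positivity) Finset.univ_nonempty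

lemma tendsto_harmonicSum : Tendsto harmonicSum atTop atTop := by
  have := Real.tendsto_sum_range_one_div_nat_succ_atTop
  refine this.congr fun N => ?_
  rw [harmonicSum, Finset.sum_range]

variable (𝕜 : Type*) [RCLike 𝕜] (p : ℝ≥0∞) (n : ℕ)

/-- The unit vectors of `ℓ_q` with coordinates `± (m + 1) ^ (-1 / q)`, normalised, the values `m`
being a cyclic shift of `0, …, n`. -/
noncomputable def signedHarmonic (ω : Fin (n + 1) × (Fin (n + 1) → ℤˣ)) : Ell 𝕜 p :=
  ∑ i : Fin (n + 1), lp.single p (i : ℕ) ((((ω.2 i : ℤ) : 𝕜)) *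
    (((1 / ((((i + ω.1 : Fin (n + 1)) : ℕ) : ℝ) + 1) /
        harmonicSum (n + 1)) ^ (1 / p.toReal) : ℝ) :
      𝕜))

variable {p n}

lemma signedHarmonic_apply (ω : Fin (n + 1) × (Fin (n + 1) → ℤˣ)) (i : Fin (n + 1)) :
    signedHarmonic 𝕜 p n ω i = ((ω.2 i : ℤ) : 𝕜) *
      (((1 / ((((i + ω.1 : Fin (n + 1)) : ℕ) : ℝ) + 1) /
        harmonicSum (n + 1)) ^ (1 / p.toReal) : ℝ) :
        𝕜) := by
  rw [signedHarmonic, lp.coeFn_sum, Finset.sum_apply, Finset.sum_eq_single i]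
  · simp
  · intro j _ hj
    have : (i : ℕ) ≠ j := fun h => hj (Fin.ext h.symm)
    exact lp.single_apply_ne _ _ _ this
  · simp

lemma norm_signedHarmonic_le [Fact (1 ≤ p)] (hp : 0 < p.toReal)
    (ω : Fin (n + 1) × (Fin (n + 1) → ℤˣ)) : ‖signedHarmonic 𝕜 p n ω‖ ≤ 1 := by
  have hH := harmonicSum_pos n
  refine lp.norm_le_of_forall_sum_le hp zero_le_one fun s => ?_
  have h0 : ∀ j, j ∉ Finset.range (n + 1) → signedHarmonic 𝕜 p n ω j = 0 := fun j hj => by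
    rw [signedHarmonic, lp.coeFn_sum, Finset.sum_apply]
    refine Finset.sum_eq_zero fun i _ => lp.single_apply_ne _ _ _ ?_
    rintro rfl
    exact hj (Finset.mem_range.mpr i.2)
  have hnn : ∀ j : ℕ, 0 ≤ ‖signedHarmonic 𝕜 p n ω j‖ ^ p.toReal := fun j => by positivity
  calc ∑ j ∈ s, ‖signedHarmonic 𝕜 p n ω j‖ ^ p.toReal
      ≤ ∑ j ∈ s ∪ Finset.range (n + 1), ‖signedHarmonic 𝕜 p n ω j‖ ^ p.toReal :=
        Finset.sum_le_sum_of_subset_of_nonneg Finset.subset_union_left fun _ _ _ => hnn _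
    _ = ∑ j ∈ Finset.range (n + 1), ‖signedHarmonic 𝕜 p n ω j‖ ^ p.toReal := by
        refine (Finset.sum_subset Finset.subset_union_right fun j _ hj => ?_).symm
        rw [h0 j hj, norm_zero, Real.zero_rpow hp.ne']
    _ = ∑ i : Fin (n + 1), 1 / ((((i + ω.1 : Fin (n + 1)) : ℕ) : ℝ) + 1) / harmonicSum (n + 1) := by
        rw [Finset.sum_range]
        refine Finset.sum_congr rfl fun i _ => ?_
        rw [signedHarmonic_apply, norm_mul, norm_signUnit, one_mul, RCLike.norm_ofReal,
          abs_of_nonneg (by positivity), ← Real.rpow_mul (by positivity),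
          one_div_mul_cancel hp.ne', Real.rpow_one]
    _ = 1 := by
        rw [← Finset.sum_div, div_eq_one_iff_eq hH.ne', harmonicSum]
        exact Equiv.sum_comp (Equiv.addRight ω.1)
          (fun m : Fin (n + 1) => 1 / (((m : ℕ) : ℝ) + 1))
    _ = 1 ^ p.toReal := (Real.one_rpow _).symm

lemma expect_signedHarmonic_apply {α : ℝ} (hαq : α.HolderConjugate p.toReal) (i : Fin (n + 1)) :
    𝔼 ω : Fin (n + 1) × (Fin (n + 1) → ℤˣ),
      (((ω.2 i : ℤ) : 𝕜) * (stableWeight α (n + 1) (i + ω.1) : 𝕜)) * signedHarmonic 𝕜 p n ω i =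
      ((((n + 1 : ℕ) : ℝ) ^ (1 / α - 1) * harmonicSum (n + 1) ^ (1 / α) : ℝ) : 𝕜) := by
  have hH := harmonicSum_pos n
  set N : ℝ := ((n + 1 : ℕ) : ℝ) with hN
  have hN0 : 0 < N := by positivity
  have hq : 1 / p.toReal = 1 - 1 / α := by
    have := hαq.inv_add_inv_eq_one
    simp only [one_div]; linarith
  have e : ∀ ω : Fin (n + 1) × (Fin (n + 1) → ℤˣ),
      (((ω.2 i : ℤ) : 𝕜) * (stableWeight α (n + 1) (i + ω.1) : 𝕜)) * signedHarmonic 𝕜 p n ω i =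
      ((N ^ (1 / α) / harmonicSum (n + 1) ^ (1 / p.toReal) *
        (1 / ((((i + ω.1 : Fin (n + 1)) : ℕ) : ℝ) + 1)) : ℝ) : 𝕜) := fun ω => by
    have hs := signUnit_mul_self (𝕜 := 𝕜) (ω.2 i)
    have hr : stableWeight α (n + 1) (i + ω.1) *
        (1 / ((((i + ω.1 : Fin (n + 1)) : ℕ) : ℝ) + 1) / harmonicSum (n + 1)) ^ (1 / p.toReal) =
        N ^ (1 / α) / harmonicSum (n + 1) ^ (1 / p.toReal) *
        (1 / ((((i + ω.1 : Fin (n + 1)) : ℕ) : ℝ) + 1)) := by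
      set a : ℝ := (((i + ω.1 : Fin (n + 1)) : ℕ) : ℝ) + 1 with ha
      have ha0 : 0 < a := by positivity
      rw [stableWeight, Real.div_rpow (by positivity) hH.le, Real.div_rpow hN0.le ha0.le,
        Real.div_rpow zero_le_one ha0.le, Real.one_rpow]
      have : a ^ (1 / α) * a ^ (1 / p.toReal) = a := by
        rw [← Real.rpow_add ha0, hq]; simp
      have h1 : 0 < a ^ (1 / α) := by positivity
      have h2 : 0 < a ^ (1 / p.toReal) := by positivity
      have h3 : 0 < harmonicSum (n + 1) ^ (1 / p.toReal) := by positivity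
      conv_rhs => rw [← this]
      field_simp
    rw [signedHarmonic_apply, ← hr, RCLike.ofReal_mul]
    linear_combination (stableWeight α (n + 1) (i + ω.1) : 𝕜) *
      (((1 / ((((i + ω.1 : Fin (n + 1)) : ℕ) : ℝ) + 1) /
        harmonicSum (n + 1)) ^ (1 / p.toReal) : ℝ) :
        𝕜) * hs
  simp only [e]
  rw [← RCLike.ofReal_expect, ← Finset.mul_expect, ← Finset.univ_product_univ,
    Finset.expect_product]
  simp only [Fintype.expect_const]
  have h1 : 𝔼 σ : Fin (n + 1), 1 / ((((i + σ : Fin (n + 1)) : ℕ) : ℝ) + 1) =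
      harmonicSum (n + 1) / N := by
    rw [Fintype.expect_eq_sum_div_card, Fintype.card_fin, harmonicSum]
    congr 1
    exact Equiv.sum_comp (Equiv.addLeft i) (fun m : Fin (n + 1) => 1 / (((m : ℕ) : ℝ) + 1))
  rw [h1]
  congr 1
  rw [hq, Real.rpow_sub hH, Real.rpow_sub hN0, Real.rpow_one, Real.rpow_one]
  have h3 : 0 < harmonicSum (n + 1) ^ (1 / α) := by positivity
  field_simp

end Harmonic

/-- For `q > 2` not every operator `ℓ_1 → ℓ_q` is absolutely `q`-summing. The operator takes the
unit vectors to all the vectors `signedHarmonic`. It is tested on truncated stable variables, viewed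
as elements of `ℓ_1`. -/
lemma exists_not_isPSumming (𝕜 : Type*) [RCLike 𝕜] {p : ℝ≥0∞} [Fact (1 ≤ p)] {α β r : ℝ}
    (hαq : α.HolderConjugate p.toReal) (hβr : β.HolderConjugate r) (hβα : β < α) (hα2 : α < 2) :
    ∃ u : Ell 𝕜 1 →L[𝕜] Ell 𝕜 p, ¬ IsPSumming p.toReal u := by
  have hq : 0 < p.toReal := hαq.symm.pos
  let D : Type := Σ n : ℕ, Fin (n + 1) × (Fin (n + 1) → ℤˣ)
  have : Encodable ((n : ℕ) × Fin (n + 1) × (Fin (n + 1) → ℤˣ)) := Encodable.ofCountable _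
  let y : ℕ → Ell 𝕜 p := fun j =>
    (Encodable.decode (α := D) j).elim 0 fun d => signedHarmonic 𝕜 p d.1 d.2
  have hy : ∀ j, ‖y j‖ ≤ 1 := fun j => by
    simp only [y]
    rcases Encodable.decode (α := D) j with _ | d
    · simp
    · exact norm_signedHarmonic_le 𝕜 hq d.2
  refine ⟨ellOneLift y 1 hy, fun hsum => ?_⟩
  obtain ⟨C, hC⟩ := hsum.exists_bound hαq.symm.lt.le
  set u : Ell 𝕜 1 →L[𝕜] Ell 𝕜 p := ellOneLift y 1 hy
  set K := stableConst α β
  have hK : 0 ≤ K := stableConst_nonneg hαq.pos hα2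
  have hbound : ∀ n : ℕ, harmonicSum (n + 1) ^ (1 / α) ≤ C * K := by
    intro n
    -- the unit vectors `e ω` span a copy of `L¹` of the finite probability space of the `ω`;
    -- the vectors `x i` are the signed weights `θ i` in it
    let e : Fin (n + 1) × (Fin (n + 1) → ℤˣ) → Ell 𝕜 1 := fun ω =>
      lp.single 1 (Encodable.encode (⟨n, ω⟩ : D)) (1 : 𝕜)
    have hue : ∀ ω, u (e ω) = signedHarmonic 𝕜 p n ω := fun ω => by
      simp only [u, e, ellOneLift_single, one_smul, y, Encodable.encodek, Option.elim]
    have hen : ∀ ω, ‖e ω‖ = 1 := fun ω => by simp [e, lp.norm_single]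
    let θ : Fin (n + 1) → Fin (n + 1) × (Fin (n + 1) → ℤˣ) → 𝕜 := fun i ω =>
      ((ω.2 i : ℤ) : 𝕜) * (stableWeight α (n + 1) (i + ω.1) : 𝕜)
    let c : 𝕜 := (Fintype.card (Fin (n + 1) × (Fin (n + 1) → ℤˣ)) : 𝕜)⁻¹
    let x : Fin (n + 1) → Ell 𝕜 1 := fun i => c • ∑ ω, θ i ω • e ω
    have hweak : weakNorm 𝕜 p.toReal x ≤ ENNReal.ofReal K := by
      refine weakNorm_le hq fun φ hφ => ?_
      have hμ : ∀ (i : Fin (n + 1)) (F : Fin (n + 1) → ℝ), 𝔼 σ, F (i + σ) = 𝔼 m, F m :=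
        fun i F => Fintype.expect_equiv (Equiv.addLeft i) _ _ fun σ => rfl
      have h := Lq_stable_coeff_le hαq hβr hβα hα2 (Nat.succ_pos n) hμ (fun ω => φ (e ω))
      have hφx : ∀ i, φ (x i) = 𝔼 ω, φ (e ω) * θ i ω := fun i => by
        simp only [x, c, map_smul, map_sum, smul_eq_mul, Fintype.expect_eq_sum_div_card,
          div_eq_inv_mul]
        simp only [mul_comm]
      have hg : (𝔼 ω, ‖φ (e ω)‖ ^ r) ^ (1 / r) ≤ 1 := by
        have hr := hβr.symm.pos
        refine Real.rpow_le_one (expect_nonneg_of fun _ => by positivity) ?_ (by positivity)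
        refine (Finset.expect_le_expect fun ω _ => ?_).trans_eq (Fintype.expect_const 1)
        refine Real.rpow_le_one (norm_nonneg _) ?_ hr.le
        exact (φ.le_opNorm _).trans (by rw [hen, mul_one]; exact hφ)
      rw [tsum_fintype]
      simp only [enorm_rpow_eq_ofReal hq.le]
      rw [← ENNReal.ofReal_sum_of_nonneg fun _ _ => by positivity,
        ENNReal.ofReal_rpow_of_nonneg hK hq.le]
      refine ENNReal.ofReal_le_ofReal ?_
      have h2 := Real.rpow_le_rpow (by positivity) (h.trans (mul_le_of_le_one_right hK hg)) hq.le
      rw [← Real.rpow_mul (Finset.sum_nonneg fun _ _ => by positivity), one_div_mul_cancel hq.ne',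
        Real.rpow_one] at h2
      simp only [hφx]
      exact h2
    have hstrong : ENNReal.ofReal (harmonicSum (n + 1) ^ (1 / α)) ≤
        strongNorm p.toReal fun i => u (x i) := by
      have hH := harmonicSum_pos n
      set N : ℝ := ((n + 1 : ℕ) : ℝ) with hN
      have hN0 : 0 < N := by positivity
      have hux : ∀ i, N ^ (1 / α - 1) * harmonicSum (n + 1) ^ (1 / α) ≤ ‖u (x i)‖ := fun i => by
        refine le_trans (le_of_eq ?_) (lp.norm_apply_le_norm (by
          rintro rfl; simp at hq) (u (x i)) (i : ℕ))
        have h1 : u (x i) (i : ℕ) = 𝔼 ω, θ i ω * signedHarmonic 𝕜 p n ω i := by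
          simp only [x, c, map_smul, map_sum, hue, lp.coeFn_smul, lp.coeFn_sum, Pi.smul_apply,
            Finset.sum_apply, smul_eq_mul, Fintype.expect_eq_sum_div_card, div_eq_inv_mul]
        rw [h1, expect_signedHarmonic_apply 𝕜 hαq i, RCLike.norm_ofReal, abs_of_nonneg]
        positivity
      rw [strongNorm, tsum_fintype]
      simp only [enorm_rpow_eq_ofReal hq.le]
      rw [← ENNReal.ofReal_sum_of_nonneg fun _ _ => by positivity,
        ENNReal.ofReal_rpow_of_nonneg (Finset.sum_nonneg fun _ _ => by positivity) (by positivity)]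
      refine ENNReal.ofReal_le_ofReal ?_
      have h2 : ∑ _i : Fin (n + 1), (N ^ (1 / α - 1) * harmonicSum (n + 1) ^ (1 / α)) ^ p.toReal ≤
          ∑ i, ‖u (x i)‖ ^ p.toReal :=
        Finset.sum_le_sum fun i _ => Real.rpow_le_rpow (by positivity) (hux i) hq.le
      refine le_trans (le_of_eq ?_) (Real.rpow_le_rpow (by positivity) h2 (by positivity))
      rw [Finset.sum_const, Finset.card_univ, Fintype.card_fin, nsmul_eq_mul, ← hN,
        Real.mul_rpow hN0.le (by positivity),
        ← Real.rpow_mul (mul_nonneg (by positivity) (by positivity)), mul_one_div_cancel hq.ne',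
        Real.rpow_one, ← mul_assoc, ← Real.rpow_add hN0]
      have : 1 / p.toReal + (1 / α - 1) = 0 := by
        have := hαq.inv_add_inv_eq_one
        simp only [one_div]; linarith
      rw [this, Real.rpow_zero, one_mul]
    have h := hC (Function.extend (fun i : Fin (n + 1) => (i : ℕ)) x 0)
    rw [map_extend_zero, strongNorm_extend hq Fin.val_injective,
      weakNorm_extend hq Fin.val_injective] at h
    have h2 := hstrong.trans (h.trans (mul_le_mul_right hweak _))
    rw [← ENNReal.ofReal_coe_nnreal, ← ENNReal.ofReal_mul (NNReal.coe_nonneg C)] at h2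
    exact (ENNReal.ofReal_le_ofReal_iff (mul_nonneg C.2 hK)).mp h2
  have hα := hαq.pos
  have hlim : Tendsto (fun n : ℕ => harmonicSum (n + 1) ^ (1 / α)) atTop atTop :=
    (tendsto_rpow_atTop (by positivity)).comp (tendsto_harmonicSum.comp (tendsto_add_atTop_nat 1))
  obtain ⟨n, hn⟩ := (hlim.eventually_gt_atTop (C * K)).exists
  exact absurd (hbound n) (not_le.mpr hn)

/-! ### The series of operators into the `ℓ_1`-sum -/

lemma Idx.toReal_natCast (k : Idx) : (((k : ℕ) : ℝ≥0∞)).toReal = ((k : ℕ) : ℝ) := by simp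

lemma Idx.three_le (k : Idx) : (3 : ℝ) ≤ ((k : ℕ) : ℝ) := by exact_mod_cast k.2

lemma Idx.holderConjugate (k : Idx) :
    (((k : ℕ) : ℝ) / (((k : ℕ) : ℝ) - 1)).HolderConjugate (((k : ℕ) : ℝ≥0∞)).toReal := by
  have := k.three_le
  rw [k.toReal_natCast]
  exact (Real.HolderConjugate.conjExponent (by linarith)).symm

lemma Idx.holderConjugate_succ (k : Idx) :
    ((((k : ℕ) : ℝ) + 1) / ((k : ℕ) : ℝ)).HolderConjugate (((k : ℕ) : ℝ) + 1) := by
  have := k.three_le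
  have h := (Real.HolderConjugate.conjExponent (p := ((k : ℕ) : ℝ) + 1) (by linarith)).symm
  rwa [Real.conjExponent, add_sub_cancel_right] at h

lemma Idx.exponent_lt (k : Idx) :
    (((k : ℕ) : ℝ) + 1) / ((k : ℕ) : ℝ) < ((k : ℕ) : ℝ) / (((k : ℕ) : ℝ) - 1) := by
  have := k.three_le
  rw [div_lt_div_iff₀ (by linarith) (by linarith)]
  nlinarith

lemma Idx.exponent_lt_two (k : Idx) : ((k : ℕ) : ℝ) / (((k : ℕ) : ℝ) - 1) < 2 := by
  have := k.three_le
  rw [div_lt_iff₀ (by linarith)]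
  linarith

section Series

variable {𝕜 : Type*} [RCLike 𝕜]

lemma Idx.isAlmostSumming (k : Idx) (u : Ell 𝕜 1 →L[𝕜] Ell 𝕜 ((k : ℕ) : ℝ≥0∞)) :
    IsAlmostSumming u :=
  isAlmostSumming_of_lt (n := (k : ℕ) + 1) (by have := k.2; omega) k.holderConjugate
    (by push_cast; exact k.holderConjugate_succ) k.exponent_lt k.exponent_lt_two u

variable {S : ∀ k : Idx, Ell 𝕜 1 →L[𝕜] Ell 𝕜 ((k : ℕ) : ℝ≥0∞)}

lemma almostSummingNorm_pos_of_not_isPSumming {k : Idx} {q : ℝ} (hq : 0 < q)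
    {u : Ell 𝕜 1 →L[𝕜] Ell 𝕜 ((k : ℕ) : ℝ≥0∞)} (hu : ¬ IsPSumming q u) :
    0 < almostSummingNorm u := by
  have hu0 : u ≠ 0 := by
    rintro rfl
    refine hu fun x _ => ?_
    simp [strongNorm, hq]
  exact_mod_cast (norm_pos_iff.mpr hu0).trans_le (k.isAlmostSumming u).norm_le

lemma norm_inclEll_le (k : Idx) : ‖inclEll 𝕜 k‖ ≤ 1 :=
  ContinuousLinearMap.opNorm_le_bound _ zero_le_one fun x => by
    rw [one_mul, inclEll, lp.singleContinuousLinearMap_apply, lp.norm_single (by simp)]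

lemma almostSummingBound_seriesTerm {k : Idx} (hk : 0 < almostSummingNorm (S k)) :
    AlmostSummingBound (seriesTerm S k) ((1 / 2) ^ (k : ℕ)) := by
  have h := (k.isAlmostSumming (S k)).bound.clm_comp
    ((((2 ^ (k : ℕ) * almostSummingNorm (S k) : ℝ) : 𝕜)⁻¹) • inclEll 𝕜 k)
  rw [ContinuousLinearMap.smul_comp] at h
  refine h.mono ?_
  rw [← NNReal.coe_le_coe, NNReal.coe_mul, coe_nnnorm]
  have hk' : (0 : ℝ) < almostSummingNorm (S k) := hk
  have h1 : ‖(((2 ^ (k : ℕ) * almostSummingNorm (S k) : ℝ) : 𝕜)⁻¹) • inclEll 𝕜 k‖ ≤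
      (2 ^ (k : ℕ) * almostSummingNorm (S k) : ℝ)⁻¹ := by
    rw [norm_smul, norm_inv, RCLike.norm_ofReal, abs_of_pos (by positivity)]
    exact mul_le_of_le_one_right (by positivity) (norm_inclEll_le k)
  calc _ ≤ (2 ^ (k : ℕ) * almostSummingNorm (S k) : ℝ)⁻¹ * almostSummingNorm (S k) := by
        exact mul_le_mul_of_nonneg_right h1 hk'.le
    _ = _ := by rw [NNReal.coe_pow, NNReal.coe_div]; push_cast; rw [one_div, inv_pow]; field_simp

lemma summable_half_pow_idx : Summable fun k : Idx => ((1 / 2 : ℝ≥0)) ^ (k : ℕ) := by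
  have h : Summable fun n : ℕ => ((1 / 2 : ℝ≥0)) ^ n := by
    rw [← NNReal.summable_coe]
    simp only [NNReal.coe_pow, NNReal.coe_div, NNReal.coe_one, NNReal.coe_ofNat]
    exact summable_geometric_two
  exact NNReal.summable_comp_injective h (i := fun k : Idx => (k : ℕ)) Subtype.val_injective

/-- The `k`-th coordinate of a sum of the series recovers `S k` up to a nonzero factor. -/
lemma eval_comp_hasSum_seriesTerm {T : Ell 𝕜 1 →L[𝕜] SumEll 𝕜} (hT : HasSum (seriesTerm S) T)
    (k : Idx) :
    lp.evalCLM 𝕜 (fun k : Idx => Ell 𝕜 ((k : ℕ) : ℝ≥0∞)) 1 k ∘L T =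
      (((2 ^ (k : ℕ) * almostSummingNorm (S k) : ℝ) : 𝕜)⁻¹) • S k := by
  ext1 x
  have h := hT.mapL (ContinuousLinearMap.apply 𝕜 (SumEll 𝕜) x)
  have h2 := h.mapL (lp.evalCLM 𝕜 (fun k : Idx => Ell 𝕜 ((k : ℕ) : ℝ≥0∞)) 1 k)
  have h3 := hasSum_single (f := fun j : Idx => lp.evalCLM 𝕜
    (fun k : Idx => Ell 𝕜 ((k : ℕ) : ℝ≥0∞)) 1 k (seriesTerm S j x)) k (fun j hj => by
      simp [seriesTerm, inclEll, lp.evalCLM, hj.symm])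
  have h4 := h2.unique h3
  refine h4.trans ?_
  simp [seriesTerm, inclEll, lp.evalCLM]

end Series

theorem mainTheorem4 (𝕜 : Type*) [RCLike 𝕜] :
    (∀ k : Idx,
      (∀ u : Ell 𝕜 1 →L[𝕜] Ell 𝕜 ((k : ℕ) : ℝ≥0∞),
        IsPSumming (((k : ℕ) : ℝ) + 1) u ∧ IsAlmostSumming u) ∧
      ∃ u : Ell 𝕜 1 →L[𝕜] Ell 𝕜 ((k : ℕ) : ℝ≥0∞), ¬ IsPSumming ((k : ℕ) : ℝ) u) ∧
    ∀ S : ∀ k : Idx, Ell 𝕜 1 →L[𝕜] Ell 𝕜 ((k : ℕ) : ℝ≥0∞),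
      (∀ k : Idx, ¬ IsPSumming ((k : ℕ) : ℝ) (S k)) →
      (∀ k : Idx, 0 < almostSummingNorm (S k)) ∧
      (Summable fun k : Idx => ‖seriesTerm S k‖) ∧
      (∀ k : Idx, IsAlmostSumming (seriesTerm S k)) ∧
      (Summable fun k : Idx => almostSummingNorm (seriesTerm S k)) ∧
      ∃ T : Ell 𝕜 1 →L[𝕜] SumEll 𝕜,
        HasSum (seriesTerm S) T ∧
        IsAlmostSumming T ∧
        Tendsto (fun F : Finset Idx => almostSummingNorm (T - ∑ k ∈ F, seriesTerm S k))
          atTop (𝓝 0) ∧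
        ∀ p : ℝ, 1 ≤ p → ¬ IsPSumming p T := by
  refine ⟨fun k => ⟨fun u => ⟨?_, k.isAlmostSumming u⟩, ?_⟩, fun S hS => ?_⟩
  · exact isPSumming_of_lt k.holderConjugate k.holderConjugate_succ k.exponent_lt
      k.exponent_lt_two u
  · have h := exists_not_isPSumming 𝕜 k.holderConjugate k.holderConjugate_succ k.exponent_lt
      k.exponent_lt_two
    rwa [k.toReal_natCast] at h
  have hk0 : ∀ k : Idx, (0 : ℝ) < ((k : ℕ) : ℝ) := fun k => by linarith [k.three_le]
  have hpos : ∀ k, 0 < almostSummingNorm (S k) := fun k =>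
    almostSummingNorm_pos_of_not_isPSumming (hk0 k) (hS k)
  have hb : ∀ k, AlmostSummingBound (seriesTerm S k) ((1 / 2) ^ (k : ℕ)) := fun k =>
    almostSummingBound_seriesTerm (hpos k)
  have hsum : Summable fun k : Idx => ‖seriesTerm S k‖ :=
    Summable.of_nonneg_of_le (fun _ => norm_nonneg _) (fun k => (hb k).norm_le)
      (NNReal.summable_coe.mpr summable_half_pow_idx)
  obtain ⟨T, hT⟩ := hsum.of_norm
  refine ⟨hpos, hsum, fun k => ⟨_, hb k⟩,
    NNReal.summable_of_le (fun k => almostSummingNorm_le (hb k)) summable_half_pow_idx,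
    T, hT, ⟨_, AlmostSummingBound.hasSum hT summable_half_pow_idx hb⟩, ?_, fun p hp hpT => ?_⟩
  · refine tendsto_of_tendsto_of_tendsto_of_le_of_le tendsto_const_nhds
      (NNReal.tendsto_tsum_compl_atTop_zero fun k : Idx => (1 / 2 : ℝ≥0) ^ (k : ℕ))
      (fun _ => zero_le) fun F => ?_
    refine almostSummingNorm_le (AlmostSummingBound.hasSum
      (u := fun k : {k // k ∉ F} => seriesTerm S k) ?_
      (NNReal.summable_comp_injective summable_half_pow_idx Subtype.val_injective) fun k => hb k)
    exact (F.hasSum_compl_iff).mpr (by rwa [sub_add_cancel])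
  · -- an index `k ≥ p` recovers from `T` the operator `S k`, which would be `k`-summing
    obtain ⟨k, hpk⟩ : ∃ k : Idx, p ≤ ((k : ℕ) : ℝ) :=
      ⟨⟨max 3 ⌈p⌉₊, le_max_left _ _⟩,
        (Nat.le_ceil p).trans (by exact_mod_cast le_max_right 3 ⌈p⌉₊)⟩
    have hc : ((2 ^ (k : ℕ) * almostSummingNorm (S k) : ℝ) : 𝕜) ≠ 0 := by
      have h : (0 : ℝ) < almostSummingNorm (S k) := hpos k
      exact_mod_cast (by positivity : (2 ^ (k : ℕ) * almostSummingNorm (S k) : ℝ) ≠ 0)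
    have h1 := (hpT.mono hp hpk).clm_comp (hk0 k)
      ((((2 ^ (k : ℕ) * almostSummingNorm (S k) : ℝ) : 𝕜)) •
        lp.evalCLM 𝕜 (fun k : Idx => Ell 𝕜 ((k : ℕ) : ℝ≥0∞)) 1 k)
    rw [ContinuousLinearMap.smul_comp, eval_comp_hasSum_seriesTerm hT, smul_smul,
      mul_inv_cancel₀ hc, one_smul] at h1
    exact hS k h1
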